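/- Let $(\Omega,\mathcal F,\mathbb P)$ be a probability space, let $H\in(0,1)$, $\alpha\in[1,2)$, and let $\widetilde M_\alpha$ be a complex-valued rotationally invariant $\alpha$-stable random measure on $\mathbb R$ with Lebesgue control measure; that is, $\widetilde M_\alpha$ assigns to each Borel set $A\subseteq\mathbb R$ of finite Lebesgue measure $|A|$ a complex random variable with $$\mathbb E\,e^{i\,\mathrm{Re}(\bar z\,\widetilde M_\alpha(A))}=e^{-|A|\,|z|^\alpha}\qquad(z\in\mathbb C),$$ its values on finitely many pairwise disjoint sets are independent, and, for every sequence $(A_n)_{n\ge 1}$ of pairwise disjoint Borel sets whose union has finite measure, $\widetilde M_\alpha\big(\bigcup_n A_n\big)=\lim_{N\to\infty}\sum_{n\le N}\widetilde M_\alpha(A_n)$ almost surely. For $f\in L^\alpha(\mathbb R;\mathbb C)$, $\int_{\mathbb R} f\,d\widetilde M_\alpha$ denotes the limit in probability of the integrals $\sum_c c\,\widetilde M_\alpha(\{s_n=c\})$ of simple functions $s_n$, supported on sets of finite measure, with $s_n\to f$ in $L^\alpha$. Let $X=\{X(t),\,t\in\mathbb R\}$ be the harmonizable fractional stable motion, that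 is, the real-valued process with almost surely continuous paths such that, for every $t\in\mathbb R$, almost surely $$X(t)=\mathrm{Re}\left(\int_{\mathbb R}\frac{e^{it\xi}-1}{|\xi|^{H+1/\alpha}}\,d\widetilde M_\alpha(\xi)\right).$$ Then, for all $\delta>0$ and $\widetilde\rho>0$, almost surely $$\sup_{-\widetilde\rho\le t'<t''\le\widetilde\rho}\ \frac{|X(t')-X(t'')|}{|t'-t''|^{H}\,\big(\log(1+|t'-t''|^{-1})\big)^{1/\alpha+\delta}}<+\infty .$$ -/

import Mathlib

open MeasureTheory ProbabilityTheory Filter Topology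
open scoped ENNReal

/-- `IsIsotropicStableRandomMeasure α m P M`: on the probability space `(Ω, P)`, the family `M A`,
indexed by the measurable sets `A` with `m A < ∞`, is a complex-valued rotationally invariant
`α`-stable random measure with control measure `m`: each `M A` is a rotationally invariant
`α`-stable complex random variable whose characteristic function is `z ↦ exp (-m A * ‖z‖ ^ α)`,
and `M` is independently scattered and almost surely `σ`-additive. The values of `M` at other
sets are irrelevant.

The sum in the last field is the limit of the partial sums: for `1 ≤ α` the series
need not converge absolutely. -/
structure IsIsotropicStableRandomMeasure {E Ω : Type*} [MeasurableSpace E] [MeasurableSpace Ω]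
    (α : ℝ) (m : Measure E) (P : Measure Ω) (M : Set E → Ω → ℂ) : Prop where
  measurable : ∀ A : Set E, MeasurableSet A → m A < ∞ → Measurable (M A)
  charFun_eq : ∀ A : Set E, MeasurableSet A → m A < ∞ → ∀ z : ℂ,
    charFun (P.map (M A)) z = ((Real.exp (-((m A).toReal * ‖z‖ ^ α)) : ℝ) : ℂ)
  indep : ∀ (n : ℕ) (A : Fin n → Set E), (∀ i, MeasurableSet (A i)) → (∀ i, m (A i) < ∞) →
    (∀ i j, i ≠ j → Disjoint (A i) (A j)) → iIndepFun (fun i => M (A i)) P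
  sigma_additive : ∀ A : ℕ → Set E, (∀ i, MeasurableSet (A i)) → m (⋃ i, A i) < ∞ →
    (∀ i j, i ≠ j → Disjoint (A i) (A j)) →
    ∀ᵐ ω ∂P, Tendsto (fun n => ∑ i ∈ Finset.range n, M (A i) ω) atTop (𝓝 (M (⋃ i, A i) ω))

/-- The integral `∑ c, c * M {s = c}` of a simple function `s`. The value `c = 0`, for which
`{s = 0}` may have infinite control measure, contributes `0`. -/
noncomputable def simpleStableIntegral {E Ω : Type*} [MeasurableSpace E]
    (M : Set E → Ω → ℂ) (s : SimpleFunc E ℂ) (ω : Ω) : ℂ :=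
  ∑ c ∈ s.range, c * M (s ⁻¹' {c}) ω

/-- `IsStableIntegral α m P M f J`: the random variable `J` is (a version of) the stochastic
integral `∫ f dM` of the function `f ∈ L^α(m)`, that is, the limit in probability of the integrals
of simple functions (vanishing off a set of finite measure) that converge to `f` in `L^α(m)`. -/
def IsStableIntegral {E Ω : Type*} [MeasurableSpace E] [MeasurableSpace Ω]
    (α : ℝ) (m : Measure E) (P : Measure Ω) (M : Set E → Ω → ℂ) (f : E → ℂ) (J : Ω → ℂ) : Prop :=
  ∃ s : ℕ → SimpleFunc E ℂ, (∀ n, (s n).FinMeasSupp m) ∧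
    Tendsto (fun n => eLpNorm (fun x => s n x - f x) (ENNReal.ofReal α) m) atTop (𝓝 0) ∧
    TendstoInMeasure P (fun n => simpleStableIntegral M (s n)) atTop J

/-- The kernel `(e^{itξ} - 1) / |ξ|^{H + 1/α}`. -/
noncomputable def hfsmKernel (H α t ξ : ℝ) : ℂ :=
  (Complex.exp (Complex.I * (t : ℂ) * (ξ : ℂ)) - 1) / ((|ξ| ^ (H + 1 / α) : ℝ) : ℂ)

/-- `X` is the harmonizable fractional stable motion with parameters `H` and `α` driven by the
random measure `M`: for every `t`, almost surely `X t = Re ∫ (e^{itξ} - 1) / |ξ|^{H + 1/α} dM(ξ)`,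
where `M` is a rotationally invariant `α`-stable random measure with Lebesgue control measure,
and `X` has almost surely continuous paths. -/
structure IsHFSM {Ω : Type*} [MeasurableSpace Ω] (H α : ℝ) (P : Measure Ω)
    (M : Set ℝ → Ω → ℂ) (X : ℝ → Ω → ℝ) : Prop where
  randomMeasure : IsIsotropicStableRandomMeasure α volume P M
  eq_integral : ∀ t : ℝ, ∃ J : Ω → ℂ,
    IsStableIntegral α volume P M (hfsmKernel H α t) J ∧ ∀ᵐ ω ∂P, X t ω = (J ω).re
  continuous : ∀ᵐ ω ∂P, Continuous fun t => X t ω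

/-! At scale `h = 2⁻ⁿ` there are about `2ⁿ` dyadic increments, each a stable integral of size about
`h ^ H` with a polynomial tail. At the level `y = h ^ H * n ^ (1 / α + δ)` a plain union bound over
the increments diverges. What saves the estimate is that all increments of one scale are integrals
against the same random measure, with kernels dominated by a single function, `hfsmEnvelope`, whose
`L^α` norm is still of order `h ^ H`. Discretising all kernels on one partition turns every
increment into a combination, with coefficients of norm at most 1, of the same independent symmetric
variables `Z i`.

These variables are split by size. Some `Z i` exceeds `y` with probability of order `(h ^ H / y) ^ α
= n ^ (-(1 + α * δ))`; this is paid once for all increments and is summable because `δ > 0`. Values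
below `y / (3 * n)` have mean zero by symmetry, so Chernoff gives each increment a probability of
order `exp (-2 * n)`, which survives multiplication by `2ⁿ`. Values in between are summed in
absolute value, hence again for all increments at once, and a Chernoff parameter of order `log n`
gives `n ^ (-2)`.

The inequality is `measureReal_exists_re_sum_gt_le` for finite sums and
`measureReal_exists_stableIntegral_gt_le` for integrals. `exists_summable_maximalBound` and
Borel–Cantelli then control the dyadic increments, and the deterministic chaining of
`exists_holder_log_bound_of_dyadic` extends the control to all pairs of points of a continuous path.
-/

/-! ### Truncated moments and Chernoff bounds for variables with a power tail. -/

section FiniteSums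

variable {Ω : Type*} [MeasurableSpace Ω] {P : Measure Ω}

/-- Layer cake: the integral of `2 * t * (q * t ^ (-α))` over `(0, τ]`, which converges at zero
because `α < 2`. -/
lemma integral_sq_indicator_le_of_tail [IsProbabilityMeasure P] {α q τ : ℝ} (hα : α < 2)
    (hq : 0 ≤ q) (hτ : 0 < τ) {Y : Ω → ℝ} (hY : Measurable Y) (hY0 : ∀ ω, 0 ≤ Y ω)
    (htail : ∀ x, 0 < x → P.real {ω | x < Y ω} ≤ q * x ^ (-α)) :
    ∫ ω, ({ω | Y ω ≤ τ}.indicator Y ω) ^ 2 ∂P ≤ 2 / (2 - α) * q * τ ^ (2 - α) := by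
  set V : Ω → ℝ := {ω | Y ω ≤ τ}.indicator Y with hV
  have hVm : Measurable V := hY.indicator (measurableSet_le hY measurable_const)
  have hV0 : ∀ ω, 0 ≤ V ω := fun ω => Set.indicator_nonneg (fun ω _ => hY0 ω) ω
  have hα' : 0 < 2 - α := by linarith
  rw [integral_eq_lintegral_of_nonneg_ae (ae_of_all _ fun ω => sq_nonneg _)
    (hVm.pow_const 2).aestronglyMeasurable]
  refine ENNReal.toReal_le_of_le_ofReal (by positivity) ?_
  have h1 := lintegral_rpow_eq_lintegral_meas_lt_mul P (ae_of_all _ hV0) hVm.aemeasurable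
    (p := 2) two_pos
  simp only [Real.rpow_two] at h1
  rw [h1]
  have h2 : ∫⁻ t in Set.Ioi 0, P {ω | t < V ω} * ENNReal.ofReal (t ^ ((2 : ℝ) - 1)) ≤
      ∫⁻ t in Set.Ioi 0, (Set.Ioc 0 τ).indicator (fun t => ENNReal.ofReal (q * t ^ (1 - α))) t := by
    refine setLIntegral_mono' measurableSet_Ioi fun t ht => ?_
    have ht0 : (0 : ℝ) < t := ht
    by_cases htτ : t ≤ τ
    · rw [Set.indicator_of_mem (show t ∈ Set.Ioc 0 τ from ⟨ht, htτ⟩)]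
      have : P {ω | t < V ω} ≤ ENNReal.ofReal (q * t ^ (-α)) := by
        rw [← ofReal_measureReal]
        refine ENNReal.ofReal_le_ofReal ((measureReal_mono ?_).trans (htail t ht0))
        intro ω hω
        simp only [Set.mem_ofPred_eq, hV, Set.indicator_apply] at hω ⊢
        split_ifs at hω with h
        · exact hω
        · linarith
      calc _ ≤ ENNReal.ofReal (q * t ^ (-α)) * ENNReal.ofReal (t ^ ((2 : ℝ) - 1)) := by gcongr
        _ = ENNReal.ofReal (q * t ^ (1 - α)) := by
          rw [← ENNReal.ofReal_mul (by positivity), mul_assoc, ← Real.rpow_add ht0]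
          congr 3
          ring
    · have : {ω | t < V ω} = ∅ := by
        ext ω
        simp only [Set.mem_ofPred_eq, Set.mem_empty_iff_false, iff_false, not_lt, hV,
          Set.indicator_apply]
        split_ifs with h
        · exact le_trans h (le_of_not_ge htτ)
        · exact ht0.le
      simp [this]
  have h3 : ∫⁻ t in Set.Ioi 0, (Set.Ioc 0 τ).indicator
      (fun t => ENNReal.ofReal (q * t ^ (1 - α))) t ≤ ENNReal.ofReal (q * (τ ^ (2 - α) / (2 - α))) := by
    rw [setLIntegral_indicator measurableSet_Ioc, Set.inter_eq_left.2 Set.Ioc_subset_Ioi_self,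
      ← ofReal_integral_eq_lintegral_ofReal]
    · rw [← intervalIntegral.integral_of_le hτ.le, intervalIntegral.integral_const_mul,
        integral_rpow (Or.inl (by linarith)), Real.zero_rpow (by linarith)]
      refine le_of_eq ?_
      congr 2
      rw [sub_zero]
      congr 1 <;> ring_nf
    · rw [← IntegrableOn, ← intervalIntegrable_iff_integrableOn_Ioc_of_le hτ.le]
      exact (intervalIntegral.intervalIntegrable_rpow' (by linarith)).const_mul q
    · filter_upwards [ae_restrict_mem measurableSet_Ioc] with t ht
      have := ht.1
      positivity
  calc _ ≤ ENNReal.ofReal 2 * ENNReal.ofReal (q * (τ ^ (2 - α) / (2 - α))) := by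
        gcongr
        exact h2.trans h3
    _ = _ := by
      rw [← ENNReal.ofReal_mul (by norm_num)]
      congr 1
      field_simp

/-- Layer cake, with the tail bound at `τ` used for all `t ≤ τ`. Above `τ`, the estimate `t ^ (-α) ≤
τ ^ (1 - α) * t⁻¹` treats `α = 1` and `α > 1` together at the price of a logarithm. -/
lemma integral_indicator_Ioc_le_of_tail [IsProbabilityMeasure P] {α q τ y : ℝ} (hα : 1 ≤ α)
    (hq : 0 ≤ q) (hτ : 0 < τ) (hτy : τ ≤ y) {Y : Ω → ℝ} (hY : Measurable Y) (hY0 : ∀ ω, 0 ≤ Y ω)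
    (htail : ∀ x, 0 < x → P.real {ω | x < Y ω} ≤ q * x ^ (-α)) :
    ∫ ω, {ω | τ < Y ω ∧ Y ω ≤ y}.indicator Y ω ∂P ≤
      q * τ ^ (1 - α) * (1 + Real.log (y / τ)) := by
  set V : Ω → ℝ := {ω | τ < Y ω ∧ Y ω ≤ y}.indicator Y with hV
  have hVm : Measurable V := hY.indicator
    ((measurableSet_lt measurable_const hY).inter (measurableSet_le hY measurable_const))
  have hV0 : ∀ ω, 0 ≤ V ω := fun ω => Set.indicator_nonneg (fun ω _ => hY0 ω) ω
  have hy : 0 < y := hτ.trans_le hτy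
  have hlog : 0 ≤ Real.log (y / τ) := Real.log_nonneg ((one_le_div hτ).2 hτy)
  rw [integral_eq_lintegral_of_nonneg_ae (ae_of_all _ hV0) hVm.aestronglyMeasurable]
  refine ENNReal.toReal_le_of_le_ofReal (by positivity) ?_
  rw [lintegral_eq_lintegral_meas_lt P (ae_of_all _ hV0) hVm.aemeasurable]
  have hbound : ∀ t, P {ω | t < V ω ∧ 0 < t} ≤
      (Set.Ioc 0 τ).indicator (fun _ => ENNReal.ofReal (q * τ ^ (-α))) t +
      (Set.Ioc τ y).indicator (fun t => ENNReal.ofReal (q * τ ^ (1 - α) * t⁻¹)) t := by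
    intro t
    by_cases ht0 : 0 < t
    swap
    · simp [ht0]
    have hle : ∀ x, 0 < x → P {ω | x < Y ω} ≤ ENNReal.ofReal (q * x ^ (-α)) := fun x hx => by
      rw [← ofReal_measureReal]
      exact ENNReal.ofReal_le_ofReal (htail x hx)
    rcases le_or_gt t τ with h | h
    · rw [Set.indicator_of_mem (show t ∈ Set.Ioc 0 τ from ⟨ht0, h⟩)]
      refine le_add_right ((measure_mono ?_).trans (hle τ hτ))
      intro ω hω
      simp only [Set.mem_ofPred_eq, hV, Set.indicator_apply] at hω ⊢
      split_ifs at hω with h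
      · exact h.1
      · linarith
    rcases le_or_gt t y with h' | h'
    · rw [Set.indicator_of_mem (show t ∈ Set.Ioc τ y from ⟨h, h'⟩)]
      refine le_add_left (((measure_mono ?_).trans (hle t ht0)).trans ?_)
      · intro ω hω
        simp only [Set.mem_ofPred_eq, hV, Set.indicator_apply] at hω ⊢
        split_ifs at hω with h
        · exact hω.1
        · linarith
      · refine ENNReal.ofReal_le_ofReal ?_
        rw [mul_assoc, show -α = (1 - α) + (-1) by ring, Real.rpow_add ht0, Real.rpow_neg_one]
        gcongr 1
        gcongr 1
        exact Real.rpow_le_rpow_of_nonpos hτ h.le (by linarith)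
    · have : {ω | t < V ω ∧ 0 < t} = ∅ := by
        ext ω
        simp only [Set.mem_ofPred_eq, Set.mem_empty_iff_false, iff_false, not_and, not_lt, hV,
          Set.indicator_apply]
        intro h1
        split_ifs at h1 with h2
        · linarith [h2.2]
        · exact h1.le
      rw [this]
      simp
  calc ∫⁻ t in Set.Ioi 0, P {ω | t < V ω}
      ≤ ∫⁻ t in Set.Ioi 0, ((Set.Ioc 0 τ).indicator (fun _ => ENNReal.ofReal (q * τ ^ (-α))) t +
        (Set.Ioc τ y).indicator (fun t => ENNReal.ofReal (q * τ ^ (1 - α) * t⁻¹)) t) := by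
        refine setLIntegral_mono' measurableSet_Ioi fun t ht => le_trans ?_ (hbound t)
        exact measure_mono fun ω hω => ⟨hω, ht⟩
    _ ≤ ∫⁻ t, ((Set.Ioc 0 τ).indicator (fun _ => ENNReal.ofReal (q * τ ^ (-α))) t +
        (Set.Ioc τ y).indicator (fun t => ENNReal.ofReal (q * τ ^ (1 - α) * t⁻¹)) t) :=
        setLIntegral_le_lintegral _ _
    _ = ENNReal.ofReal (q * τ ^ (1 - α)) +
        ENNReal.ofReal (q * τ ^ (1 - α) * Real.log (y / τ)) := by
        rw [lintegral_add_left (measurable_const.indicator measurableSet_Ioc),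
          lintegral_indicator measurableSet_Ioc, lintegral_indicator measurableSet_Ioc]
        congr 1
        · rw [setLIntegral_const, Real.volume_Ioc, ← ENNReal.ofReal_mul (by positivity), sub_zero,
            mul_assoc, sub_eq_add_neg, add_comm 1, Real.rpow_add hτ, Real.rpow_one]
        · rw [← ofReal_integral_eq_lintegral_ofReal]
          · rw [← intervalIntegral.integral_of_le hτy, intervalIntegral.integral_const_mul,
              integral_inv_of_pos hτ hy]
          · rw [← IntegrableOn, ← intervalIntegrable_iff_integrableOn_Ioc_of_le hτy]
            refine IntervalIntegrable.const_mul ?_ _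
            refine intervalIntegral.intervalIntegrable_inv (fun x hx => ?_) continuousOn_id
            rw [Set.uIcc_of_le hτy] at hx
            exact (hτ.trans_le hx.1).ne'
          · filter_upwards [ae_restrict_mem measurableSet_Ioc] with t ht
            have : 0 < t := hτ.trans ht.1
            positivity
    _ = _ := by
        rw [← ENNReal.ofReal_add (by positivity) (by positivity)]
        congr 1
        ring

/-- `exp x ≤ 1 + x + x ^ 2` for `|x| ≤ 1`, and the linear term integrates to zero. -/
lemma mgf_inv_le_exp_of_abs_le [IsProbabilityMeasure P] {τ v : ℝ} (hτ : 0 < τ) {V : Ω → ℝ}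
    (hV : Measurable V) (hVτ : ∀ ω, |V ω| ≤ τ) (hV0 : ∫ ω, V ω ∂P = 0)
    (hv : ∫ ω, V ω ^ 2 ∂P ≤ v) : mgf V P τ⁻¹ ≤ Real.exp (v / τ ^ 2) := by
  have hi : Integrable V P := Integrable.of_bound hV.aestronglyMeasurable τ (ae_of_all _ hVτ)
  have hi2 : Integrable (fun ω => V ω ^ 2) P := by
    refine Integrable.of_bound (hV.pow_const 2).aestronglyMeasurable (τ ^ 2) (ae_of_all _ fun ω => ?_)
    rw [Real.norm_eq_abs, abs_pow]
    exact pow_le_pow_left₀ (abs_nonneg _) (hVτ ω) 2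
  have hpt : ∀ ω, Real.exp (τ⁻¹ * V ω) ≤ 1 + τ⁻¹ * V ω + (τ ^ 2)⁻¹ * V ω ^ 2 := by
    intro ω
    have h1 : |τ⁻¹ * V ω| ≤ 1 := by
      rw [abs_mul, abs_of_pos (inv_pos.2 hτ), inv_mul_le_iff₀ hτ, mul_one]
      exact hVτ ω
    have h2 := Real.abs_exp_sub_one_sub_id_le h1
    have h3 := le_abs_self (Real.exp (τ⁻¹ * V ω) - 1 - τ⁻¹ * V ω)
    have h4 : (τ⁻¹ * V ω) ^ 2 = (τ ^ 2)⁻¹ * V ω ^ 2 := by rw [mul_pow, inv_pow]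
    linarith
  have hint : Integrable (fun ω => 1 + τ⁻¹ * V ω + (τ ^ 2)⁻¹ * V ω ^ 2) P :=
    ((integrable_const _).add (hi.const_mul _)).add (hi2.const_mul _)
  calc mgf V P τ⁻¹ ≤ ∫ ω, (1 + τ⁻¹ * V ω + (τ ^ 2)⁻¹ * V ω ^ 2) ∂P :=
        integral_mono_of_nonneg (ae_of_all _ fun ω => (Real.exp_pos _).le) hint (ae_of_all _ hpt)
    _ = 1 + (τ ^ 2)⁻¹ * ∫ ω, V ω ^ 2 ∂P := by
        have hi1 : Integrable (fun ω => 1 + τ⁻¹ * V ω) P :=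
          (integrable_const _).add (hi.const_mul _)
        rw [integral_add hi1 (hi2.const_mul _), integral_add (integrable_const _) (hi.const_mul _),
          integral_const_mul, integral_const_mul, hV0]
        simp
    _ ≤ 1 + v / τ ^ 2 := by
        rw [div_eq_inv_mul]
        gcongr
    _ ≤ _ := by linarith [Real.add_one_le_exp (v / τ ^ 2)]

/-- Only a first moment is needed here: `exp x - 1 ≤ x * exp x ≤ x * exp θ` for `0 ≤ x ≤ θ`. -/
lemma mgf_le_exp_of_nonneg_of_le [IsProbabilityMeasure P] {y w θ : ℝ} (hy : 0 < y) (hθ : 0 ≤ θ)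
    {W : Ω → ℝ} (hW : Measurable W) (hW0 : ∀ ω, 0 ≤ W ω) (hWy : ∀ ω, W ω ≤ y)
    (hw : ∫ ω, W ω ∂P ≤ w) : mgf W P (θ / y) ≤ Real.exp (θ * Real.exp θ * (w / y)) := by
  have hi : Integrable W P := Integrable.of_bound hW.aestronglyMeasurable y
    (ae_of_all _ fun ω => by rw [Real.norm_eq_abs, abs_of_nonneg (hW0 ω)]; exact hWy ω)
  have hpt : ∀ ω, Real.exp (θ / y * W ω) ≤ 1 + θ / y * Real.exp θ * W ω := by
    intro ω
    set x := θ / y * W ω with hx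
    have hx0 : 0 ≤ x := mul_nonneg (by positivity) (hW0 ω)
    have hxθ : x ≤ θ := by
      rw [hx, div_mul_eq_mul_div, div_le_iff₀ hy]
      exact mul_le_mul_of_nonneg_left (hWy ω) hθ
    have h1 : Real.exp x - 1 ≤ x * Real.exp x := by
      have h := Real.add_one_le_exp (-x)
      have h2 : Real.exp (-x) * Real.exp x = 1 := by rw [← Real.exp_add]; simp
      nlinarith [Real.exp_pos x]
    have h2 : x * Real.exp x ≤ x * Real.exp θ := by gcongr
    have h3 : θ / y * Real.exp θ * W ω = x * Real.exp θ := by rw [hx]; ring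
    linarith
  calc mgf W P (θ / y) ≤ ∫ ω, (1 + θ / y * Real.exp θ * W ω) ∂P :=
        integral_mono_of_nonneg (ae_of_all _ fun ω => (Real.exp_pos _).le)
          ((integrable_const _).add (hi.const_mul _)) (ae_of_all _ hpt)
    _ = 1 + θ / y * Real.exp θ * ∫ ω, W ω ∂P := by
        rw [integral_add (integrable_const _) (hi.const_mul _), integral_const_mul]
        simp
    _ ≤ 1 + θ / y * Real.exp θ * w := by gcongr
    _ = θ * Real.exp θ * (w / y) + 1 := by ring
    _ ≤ _ := Real.add_one_le_exp _

lemma measureReal_sum_ge_le_exp [IsProbabilityMeasure P] {ι : Type*} [Fintype ι] {X : ι → Ω → ℝ}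
    (hX : ∀ i, Measurable (X i)) (hind : iIndepFun X P) {b : ℝ} (hb : ∀ i ω, |X i ω| ≤ b)
    {a : ι → ℝ} {t r : ℝ} (ht : 0 ≤ t)
    (ha : ∀ i, mgf (X i) P t ≤ Real.exp (a i)) :
    P.real {ω | r ≤ ∑ i, X i ω} ≤ Real.exp (-t * r + ∑ i, a i) := by
  have hbd : ∀ ω, |∑ i, X i ω| ≤ Fintype.card ι * b := fun ω =>
    (Finset.abs_sum_le_sum_abs _ _).trans ((Finset.sum_le_sum fun i _ => hb i ω).trans (by simp))
  have hm : Measurable fun ω => ∑ i, X i ω := Finset.measurable_sum _ fun i _ => hX i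
  have hint : Integrable (fun ω => Real.exp (t * ∑ i, X i ω)) P := by
    refine Integrable.of_bound (by fun_prop) (Real.exp (t * (Fintype.card ι * b)))
      (ae_of_all _ fun ω => ?_)
    rw [Real.norm_eq_abs, Real.abs_exp]
    gcongr
    exact (le_abs_self _).trans (hbd ω)
  refine (measure_ge_le_exp_mul_mgf r ht hint).trans ?_
  have := hind.mgf_sum hX Finset.univ (t := t)
  have h2 : mgf (fun ω => ∑ i, X i ω) P t = ∏ i, mgf (X i) P t := by
    rw [← this]
    congr 1
    ext ω
    simp
  rw [h2, Real.exp_add, Real.exp_sum]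
  gcongr with i
  · exact fun i _ => mgf_nonneg
  · exact ha i

end FiniteSums

/-! ### The maximal inequality for finitely many combinations of independent symmetric variables. -/

section MaximalInequality

variable {Ω : Type*} [MeasurableSpace Ω] {P : Measure Ω}

lemma integral_comp_eq_zero_of_map_neg_eq {Z : Ω → ℂ} (hZ : Measurable Z)
    (hsymm : P.map (fun ω => -Z ω) = P.map Z) {g : ℂ → ℝ} (hg : Measurable g)
    (hodd : ∀ z, g (-z) = -g z) : ∫ ω, g (Z ω) ∂P = 0 := by
  have h1 : ∫ ω, g (Z ω) ∂P = ∫ ω, g (-Z ω) ∂P := by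
    rw [← integral_map hZ.aemeasurable hg.aestronglyMeasurable, ← hsymm,
      integral_map (φ := fun ω => -Z ω) hZ.neg.aemeasurable hg.aestronglyMeasurable]
  simp only [hodd, integral_neg] at h1
  linarith

variable [IsProbabilityMeasure P] {ι : Type*} [Fintype ι] {α : ℝ} {Z : ι → Ω → ℂ} {q : ι → ℝ}

/-- The truncation is odd, so symmetry makes the truncated summands centred and only their variance
enters the Chernoff bound at parameter `τ⁻¹`. -/
lemma measureReal_sum_small_ge_le (hα : α < 2) (hZ : ∀ i, Measurable (Z i)) (hind : iIndepFun Z P)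
    (hsymm : ∀ i, P.map (fun ω => -Z i ω) = P.map (Z i)) (hq : ∀ i, 0 ≤ q i)
    (htail : ∀ i x, 0 < x → P.real {ω | x < ‖Z i ω‖} ≤ q i * x ^ (-α))
    {c : ι → ℂ} (hc : ∀ i, ‖c i‖ ≤ 1) {τ r : ℝ} (hτ : 0 < τ) :
    P.real {ω | r ≤ ∑ i, (c i * {z : ℂ | ‖z‖ ≤ τ}.indicator id (Z i ω)).re} ≤
      Real.exp (-(r / τ) + 2 / (2 - α) * (∑ i, q i) * τ ^ (-α)) := by
  set g : ι → ℂ → ℝ := fun i z => (c i * {z : ℂ | ‖z‖ ≤ τ}.indicator id z).re with hg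
  have hset : MeasurableSet {z : ℂ | ‖z‖ ≤ τ} := measurableSet_le measurable_norm measurable_const
  have hgm : ∀ i, Measurable (g i) := fun i =>
    Complex.measurable_re.comp (measurable_const.mul (measurable_id.indicator hset))
  have hle : ∀ i z, |g i z| ≤ ‖{z : ℂ | ‖z‖ ≤ τ}.indicator id z‖ := fun i z => by
    refine (Complex.abs_re_le_norm _).trans ?_
    rw [norm_mul]
    exact mul_le_of_le_one_left (norm_nonneg _) (hc i)
  have hb : ∀ i z, |g i z| ≤ τ := fun i z => (hle i z).trans <| by
    by_cases h : ‖z‖ ≤ τ <;> simp [Set.indicator, h, hτ.le]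
  have hodd : ∀ i z, g i (-z) = -g i z := fun i z => by
    by_cases h : ‖z‖ ≤ τ <;> simp [hg, Set.indicator, h]
  have hmgf : ∀ i, mgf (fun ω => g i (Z i ω)) P τ⁻¹ ≤
      Real.exp (2 / (2 - α) * q i * τ ^ (2 - α) / τ ^ 2) := by
    intro i
    refine mgf_inv_le_exp_of_abs_le hτ ((hgm i).comp (hZ i)) (fun ω => hb i _)
      (integral_comp_eq_zero_of_map_neg_eq (hZ i) (hsymm i) (hgm i) (hodd i)) ?_
    refine le_trans ?_ (integral_sq_indicator_le_of_tail hα (hq i) hτ (hZ i).norm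
      (fun ω => norm_nonneg _) (htail i))
    have hms : MeasurableSet {ω | ‖Z i ω‖ ≤ τ} := measurableSet_le (hZ i).norm measurable_const
    refine integral_mono_of_nonneg (ae_of_all _ fun ω => sq_nonneg _) ?_ (ae_of_all _ fun ω => ?_)
    · refine Integrable.of_bound (((hZ i).norm.indicator hms).pow_const 2).aestronglyMeasurable
        (τ ^ 2) (ae_of_all _ fun ω => ?_)
      rw [norm_pow]
      refine pow_le_pow_left₀ (norm_nonneg _) ?_ 2
      by_cases h : ‖Z i ω‖ ≤ τ <;> simp [Set.indicator, h, hτ.le]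
    · beta_reduce
      rw [← sq_abs]
      refine pow_le_pow_left₀ (abs_nonneg _) ((hle i _).trans (le_of_eq ?_)) 2
      by_cases h : ‖Z i ω‖ ≤ τ <;> simp [Set.indicator, h]
  refine (measureReal_sum_ge_le_exp (fun i => (hgm i).comp (hZ i)) (hind.comp g hgm)
    (fun i ω => hb i _) (inv_nonneg.2 hτ.le) hmgf).trans (le_of_eq ?_)
  rw [← Finset.sum_div, ← Finset.sum_mul, ← Finset.mul_sum, sub_eq_add_neg, Real.rpow_add hτ,
    Real.rpow_two]
  congr 1
  field_simp

/-- Absolute values are summed, without coefficients, so that one event serves every linear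
combination. -/
lemma measureReal_sum_mid_ge_le (hα : 1 ≤ α) (hZ : ∀ i, Measurable (Z i)) (hind : iIndepFun Z P)
    (hq : ∀ i, 0 ≤ q i)
    (htail : ∀ i x, 0 < x → P.real {ω | x < ‖Z i ω‖} ≤ q i * x ^ (-α))
    {τ y θ R : ℝ} (hτ : 0 < τ) (hτy : τ ≤ y) (hθ : 0 ≤ θ) :
    P.real {ω | R * y ≤ ∑ i, {z : ℂ | τ < ‖z‖ ∧ ‖z‖ ≤ y}.indicator norm (Z i ω)} ≤
      Real.exp (-θ * R +
        θ * Real.exp θ * ((∑ i, q i) * τ ^ (1 - α) * (1 + Real.log (y / τ)) / y)) := by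
  set g : ℂ → ℝ := {z : ℂ | τ < ‖z‖ ∧ ‖z‖ ≤ y}.indicator norm with hg
  have hy : 0 < y := hτ.trans_le hτy
  have hgm : Measurable g := measurable_norm.indicator
    ((measurableSet_lt measurable_const measurable_norm).inter
      (measurableSet_le measurable_norm measurable_const))
  have hg0 : ∀ z, 0 ≤ g z := fun z => Set.indicator_nonneg (fun _ _ => norm_nonneg _) z
  have hgy : ∀ z, g z ≤ y := fun z => Set.indicator_le' (fun _ h => h.2) (fun _ _ => hy.le) z
  have hmgf : ∀ i, mgf (fun ω => g (Z i ω)) P (θ / y) ≤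
      Real.exp (θ * Real.exp θ * (q i * τ ^ (1 - α) * (1 + Real.log (y / τ)) / y)) := fun i =>
    mgf_le_exp_of_nonneg_of_le hy hθ (hgm.comp (hZ i)) (fun ω => hg0 _) (fun ω => hgy _)
      (integral_indicator_Ioc_le_of_tail hα (hq i) hτ hτy (hZ i).norm
        (fun ω => norm_nonneg _) (htail i))
  refine (measureReal_sum_ge_le_exp (fun i => hgm.comp (hZ i)) (hind.comp (fun _ => g) fun _ => hgm)
    (b := y) (fun i ω => ?_) (by positivity) hmgf).trans (le_of_eq ?_)
  · simp only [Function.comp_apply]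
    rw [abs_of_nonneg (hg0 _)]
    exact hgy _
  · rw [← Finset.mul_sum, ← Finset.sum_div, ← Finset.sum_mul, ← Finset.sum_mul]
    congr 2
    field_simp

/-- Only the exponentially small term, from values below `y / L`, carries the number of
combinations. The large and the intermediate values are controlled by events that do not depend on
`k`. -/
theorem measureReal_exists_re_sum_gt_le {κ : Type*} [Fintype κ] (hα : 1 ≤ α) (hα2 : α < 2)
    (hZ : ∀ i, Measurable (Z i)) (hind : iIndepFun Z P)
    (hsymm : ∀ i, P.map (fun ω => -Z i ω) = P.map (Z i)) (hq : ∀ i, 0 ≤ q i)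
    (htail : ∀ i x, 0 < x → P.real {ω | x < ‖Z i ω‖} ≤ q i * x ^ (-α))
    {c : κ → ι → ℂ} (hc : ∀ k i, ‖c k i‖ ≤ 1) {y L θ R Q : ℝ} (hy : 0 < y) (hL : 1 ≤ L)
    (hθ : 0 ≤ θ) (hQ : (∑ i, q i) * y ^ (-α) ≤ Q) :
    P.real {ω | ∃ k, (R + 1) * y < |(∑ i, c k i * Z i ω).re|} ≤
      Q + 2 * Fintype.card κ * Real.exp (-L + 2 / (2 - α) * (Q * L ^ α)) +
        Real.exp (-θ * R + θ * Real.exp θ * (Q * L ^ (α - 1) * (1 + Real.log L))) := by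
  have hL0 : 0 < L := one_pos.trans_le hL
  set τ : ℝ := y / L with hτdef
  have hτ : 0 < τ := by positivity
  have hτy : τ ≤ y := div_le_self hy.le hL
  have hyτ : y / τ = L := by rw [hτdef]; field_simp
  set V : κ → ι → Ω → ℝ := fun k i ω => (c k i * {z : ℂ | ‖z‖ ≤ τ}.indicator id (Z i ω)).re with hV
  set W : ι → Ω → ℝ := fun i ω => {z : ℂ | τ < ‖z‖ ∧ ‖z‖ ≤ y}.indicator norm (Z i ω) with hW
  have hτα : τ ^ (-α) = y ^ (-α) * L ^ α := by
    rw [hτdef, Real.div_rpow hy.le hL0.le, Real.rpow_neg hL0.le, div_inv_eq_mul]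
  have hτα' : τ ^ (1 - α) / y = y ^ (-α) * L ^ (α - 1) := by
    rw [hτdef, Real.div_rpow hy.le hL0.le, show α - 1 = -(1 - α) by ring, Real.rpow_neg hL0.le,
      sub_eq_add_neg, Real.rpow_add hy, Real.rpow_one]
    field_simp
  have hlog : 0 ≤ Real.log L := Real.log_nonneg hL
  have hα2' : 0 < 2 - α := by linarith
  -- Off these events no variable exceeds `y`, so a summand differs from its small part `V` by at
  -- most `W`; the small parts contribute less than `y` and the `W` less than `R * y`.
  have hsub : {ω | ∃ k, (R + 1) * y < |(∑ i, c k i * Z i ω).re|} ⊆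
      ((⋃ i, {ω | y < ‖Z i ω‖}) ∪
        ⋃ k, ({ω | y ≤ ∑ i, V k i ω} ∪ {ω | y ≤ ∑ i, -V k i ω})) ∪
        {ω | R * y ≤ ∑ i, W i ω} := by
    rintro ω ⟨k, hk⟩
    by_contra hcon
    simp only [Set.mem_union, Set.mem_iUnion, Set.mem_ofPred_eq, not_or, not_exists, not_lt,
      not_le] at hcon
    obtain ⟨⟨h1, h2⟩, h3⟩ := hcon
    have hdec : ∀ i, |(c k i * Z i ω).re - V k i ω| ≤ W i ω := by
      intro i
      rcases le_or_gt ‖Z i ω‖ τ with h | h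
      · simp [hV, hW, Set.indicator, h, not_lt.2 h]
      · simp only [hV, hW, Set.indicator, Set.mem_ofPred_eq, h, not_le.2 h, h1 i, and_self, if_true,
          if_false, mul_zero, Complex.zero_re, sub_zero]
        refine (Complex.abs_re_le_norm _).trans ?_
        rw [norm_mul]
        exact mul_le_of_le_one_left (norm_nonneg _) (hc k i)
    have h4 : |∑ i, V k i ω| < y := by
      have := h2 k
      rw [Finset.sum_neg_distrib] at this
      exact abs_lt.2 ⟨by linarith [this.2], this.1⟩
    have h5 : |(∑ i, c k i * Z i ω).re - ∑ i, V k i ω| ≤ ∑ i, W i ω := by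
      rw [Complex.re_sum, ← Finset.sum_sub_distrib]
      exact (Finset.abs_sum_le_sum_abs _ _).trans (Finset.sum_le_sum fun i _ => hdec i)
    have h6 := abs_sub_abs_le_abs_sub (∑ i, c k i * Z i ω).re (∑ i, V k i ω)
    linarith
  have hbig : P.real (⋃ i, {ω | y < ‖Z i ω‖}) ≤ Q :=
    (measureReal_iUnion_fintype_le _).trans (((Finset.sum_le_sum fun i _ => htail i y hy).trans
      (Finset.sum_mul _ _ _).ge).trans hQ)
  have hexp : ∀ c' : ι → ℂ, (∀ i, ‖c' i‖ ≤ 1) →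
      P.real {ω | y ≤ ∑ i, (c' i * {z : ℂ | ‖z‖ ≤ τ}.indicator id (Z i ω)).re} ≤
        Real.exp (-L + 2 / (2 - α) * (Q * L ^ α)) := by
    intro c' hc'
    refine (measureReal_sum_small_ge_le hα2 hZ hind hsymm hq htail hc' hτ).trans ?_
    rw [hyτ, hτα, mul_assoc, ← mul_assoc (∑ i, q i)]
    gcongr
  have hsmall : P.real (⋃ k, ({ω | y ≤ ∑ i, V k i ω} ∪ {ω | y ≤ ∑ i, -V k i ω})) ≤
      2 * Fintype.card κ * Real.exp (-L + 2 / (2 - α) * (Q * L ^ α)) := by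
    have h : ∀ k, P.real ({ω | y ≤ ∑ i, V k i ω} ∪ {ω | y ≤ ∑ i, -V k i ω}) ≤
        2 * Real.exp (-L + 2 / (2 - α) * (Q * L ^ α)) := by
      intro k
      have h1 := hexp (c k) (hc k)
      have h2 := hexp (fun i => -c k i) (fun i => by rw [norm_neg]; exact hc k i)
      simp only [neg_mul, Complex.neg_re] at h2
      exact (measureReal_union_le _ _).trans (by linarith)
    refine (measureReal_iUnion_fintype_le _).trans ((Finset.sum_le_sum fun k _ => h k).trans ?_)
    rw [Finset.sum_const, nsmul_eq_mul, Finset.card_univ]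
    exact le_of_eq (by ring)
  have hmid : P.real {ω | R * y ≤ ∑ i, W i ω} ≤
      Real.exp (-θ * R + θ * Real.exp θ * (Q * L ^ (α - 1) * (1 + Real.log L))) := by
    refine (measureReal_sum_mid_ge_le hα hZ hind hq htail hτ hτy hθ).trans ?_
    rw [hyτ, mul_div_right_comm, mul_div_assoc, hτα', ← mul_assoc (∑ i, q i)]
    gcongr
  calc _ ≤ _ := measureReal_mono hsub
    _ ≤ _ := measureReal_union_le _ _
    _ ≤ _ := add_le_add (measureReal_union_le _ _) hmid
    _ ≤ _ := by linarith

end MaximalInequality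

/-! ### Tails of isotropic stable laws on the plane. -/

section CharFunTail

/-- The tail is bounded by an average of `1 - charFun` over `|t| ≤ 2 / r`, where `1 - exp (-u) ≤ u`
applies. The constant is `2 * 2 ^ α ≤ 8`. -/
lemma measureReal_abs_inner_gt_le_of_charFun {μ : Measure ℂ} [IsProbabilityMeasure μ] {α σ r : ℝ}
    (hα : 0 < α) (hα2 : α ≤ 2) (hσ : 0 ≤ σ)
    (hμ : ∀ z : ℂ, charFun μ z = ((Real.exp (-(σ * ‖z‖ ^ α)) : ℝ) : ℂ)) (hr : 0 < r)
    {a : ℂ} (ha : ‖a‖ = 1) : μ.real {x | r < |inner ℝ a x|} ≤ 8 * σ * r ^ (-α) := by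
  refine (measureReal_abs_inner_gt_le_integral_charFun hr).trans ?_
  have hb : ∀ t ∈ Set.uIoc (-2 * r⁻¹) (2 * r⁻¹), ‖1 - charFun μ (t • a)‖ ≤ σ * (2 * r⁻¹) ^ α := by
    intro t ht
    have hr' : -2 * r⁻¹ ≤ 2 * r⁻¹ := by nlinarith [inv_pos.2 hr]
    rw [Set.uIoc_of_le hr'] at ht
    have ht' : |t| ≤ 2 * r⁻¹ := abs_le.2 ⟨by linarith [ht.1], ht.2⟩
    rw [hμ, norm_smul, ha, mul_one, Real.norm_eq_abs, ← Complex.ofReal_one, ← Complex.ofReal_sub,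
      Complex.norm_real, Real.norm_eq_abs, abs_of_nonneg]
    · have h1 := Real.add_one_le_exp (-(σ * |t| ^ α))
      have h2 : σ * |t| ^ α ≤ σ * (2 * r⁻¹) ^ α := by gcongr
      linarith
    · have : 0 ≤ σ * |t| ^ α := by positivity
      simpa using this
  have h4 : (2 : ℝ) ^ α ≤ 4 := by
    calc (2 : ℝ) ^ α ≤ 2 ^ (2 : ℝ) := Real.rpow_le_rpow_of_exponent_le (by norm_num) hα2
      _ = 4 := by norm_num
  calc _ ≤ 2⁻¹ * r * (σ * (2 * r⁻¹) ^ α * |2 * r⁻¹ - -2 * r⁻¹|) := by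
        gcongr
        exact intervalIntegral.norm_integral_le_of_norm_le_const hb
    _ = 2 * σ * (2 ^ α * r ^ (-α)) := by
        rw [show 2 * r⁻¹ - -2 * r⁻¹ = 4 * r⁻¹ by ring, abs_of_pos (by positivity),
          Real.mul_rpow (by norm_num) (by positivity), Real.inv_rpow hr.le, Real.rpow_neg hr.le]
        field_simp
        ring
    _ ≤ 2 * σ * (4 * r ^ (-α)) := by gcongr
    _ = _ := by ring

/-- A vector longer than `r` has a coordinate larger than `r / 2`; two axes and `2 ^ α ≤ 4` give `64
= 2 * 8 * 4`. -/
lemma measureReal_norm_gt_le_of_charFun {μ : Measure ℂ} [IsProbabilityMeasure μ] {α σ r : ℝ}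
    (hα : 0 < α) (hα2 : α ≤ 2) (hσ : 0 ≤ σ)
    (hμ : ∀ z : ℂ, charFun μ z = ((Real.exp (-(σ * ‖z‖ ^ α)) : ℝ) : ℂ)) (hr : 0 < r) :
    μ.real {x | r < ‖x‖} ≤ 64 * σ * r ^ (-α) := by
  have hr2 : 0 < r / 2 := by positivity
  have hsub : {x : ℂ | r < ‖x‖} ⊆
      {x | r / 2 < |inner ℝ (1 : ℂ) x|} ∪ {x | r / 2 < |inner ℝ Complex.I x|} := by
    intro x hx
    by_contra hcon
    simp only [Set.mem_union, Set.mem_ofPred_eq, not_or, not_lt, Complex.inner, map_one, mul_one,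
      Complex.conj_I, mul_neg, Complex.neg_re, Complex.mul_I_re, neg_neg] at hcon hx
    linarith [Complex.norm_le_abs_re_add_abs_im x]
  have h4 : (2 : ℝ) ^ α ≤ 4 := by
    calc (2 : ℝ) ^ α ≤ 2 ^ (2 : ℝ) := Real.rpow_le_rpow_of_exponent_le (by norm_num) hα2
      _ = 4 := by norm_num
  have hr4 : (r / 2) ^ (-α) ≤ 4 * r ^ (-α) := by
    rw [Real.div_rpow hr.le (by norm_num), Real.rpow_neg (by norm_num : (0 : ℝ) ≤ 2), div_inv_eq_mul,
      mul_comm]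
    gcongr
  have h1 := measureReal_abs_inner_gt_le_of_charFun hα hα2 hσ hμ hr2 (a := 1) (by simp)
  have hI := measureReal_abs_inner_gt_le_of_charFun hα hα2 hσ hμ hr2 (a := Complex.I) (by simp)
  have h8 : 8 * σ * (r / 2) ^ (-α) ≤ 8 * σ * (4 * r ^ (-α)) := by gcongr
  have := (measureReal_mono (μ := μ) hsub).trans (measureReal_union_le _ _)
  linarith

end CharFunTail

/-! ### Integrals of simple functions against a stable random measure. -/

lemma MeasureTheory.TendstoInMeasure.sub {Ω E : Type*} [MeasurableSpace Ω] {P : Measure Ω}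
    [SeminormedAddCommGroup E] {f f' : ℕ → Ω → E} {g g' : Ω → E}
    (h : TendstoInMeasure P f atTop g) (h' : TendstoInMeasure P f' atTop g') :
    TendstoInMeasure P (fun n ω => f n ω - f' n ω) atTop (fun ω => g ω - g' ω) := by
  rw [tendstoInMeasure_iff_norm] at *
  intro ε hε
  have h0 := (h (ε / 2) (by positivity)).add (h' (ε / 2) (by positivity))
  rw [add_zero] at h0
  refine tendsto_of_tendsto_of_tendsto_of_le_of_le tendsto_const_nhds h0 (fun n => zero_le)
    fun n => (measure_mono fun ω hω => ?_).trans (measure_union_le _ _)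
  by_contra hcon
  simp only [Set.mem_union, Set.mem_ofPred_eq, not_or, not_le] at hcon hω
  have := norm_sub_le (f n ω - g ω) (f' n ω - g' ω)
  rw [show f n ω - g ω - (f' n ω - g' ω) = f n ω - f' n ω - (g ω - g' ω) by abel] at this
  linarith

lemma MeasureTheory.SimpleFunc.sum_norm_rpow_mul_measure_eq {E F : Type*} [MeasurableSpace E]
    [NormedAddCommGroup F] [DecidablePred fun v : F => v ≠ 0] {m : Measure E} {α : ℝ} (hα : 0 < α)
    {S : SimpleFunc E F}
    (hS : S.FinMeasSupp m) :
    ∑ v ∈ S.range with v ≠ 0, ‖v‖ ^ α * (m (S ⁻¹' {v})).toReal =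
      (eLpNorm S (ENNReal.ofReal α) m).toReal ^ α := by
  rw [eLpNorm_eq_eLpNorm' (by simpa using hα) ENNReal.ofReal_ne_top, ENNReal.toReal_ofReal hα.le,
    SimpleFunc.eLpNorm'_eq, ENNReal.toReal_rpow, ← ENNReal.rpow_mul, one_div_mul_cancel hα.ne',
    ENNReal.rpow_one, ENNReal.toReal_sum, Finset.sum_filter]
  · refine Finset.sum_congr rfl fun v _ => ?_
    by_cases hv : v = 0
    · simp [hv, hα]
    · rw [if_pos hv, ENNReal.toReal_mul, ← ENNReal.toReal_rpow, toReal_enorm]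
  · intro v _
    by_cases hv : v = 0
    · simp [hv, hα]
    · exact ENNReal.mul_ne_top (ENNReal.rpow_ne_top_of_nonneg hα.le enorm_ne_top)
        (hS.meas_preimage_singleton_ne_zero hv).ne

namespace IsIsotropicStableRandomMeasure

variable {E Ω : Type*} [MeasurableSpace E] [MeasurableSpace Ω] {α : ℝ} {m : Measure E}
  {P : Measure Ω} {M : Set E → Ω → ℂ}

lemma empty_ae_eq (hM : IsIsotropicStableRandomMeasure α m P M) : ∀ᵐ ω ∂P, M ∅ ω = 0 := by
  have h := hM.sigma_additive (fun _ => ∅) (fun _ => MeasurableSet.empty) (by simp)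
    (fun _ _ _ => disjoint_bot_left)
  filter_upwards [h] with ω hω
  -- The partial sums of a constant series converge, so their common increment `M ∅ ω` is zero.
  have h2 := ((tendsto_add_atTop_iff_nat 1).2 hω).sub hω
  simp only [Finset.sum_range_succ, add_sub_cancel_left, sub_self] at h2
  exact tendsto_nhds_unique tendsto_const_nhds h2

lemma union_ae_eq (hM : IsIsotropicStableRandomMeasure α m P M) {A B : Set E}
    (hA : MeasurableSet A) (hB : MeasurableSet B) (hmA : m A < ∞) (hmB : m B < ∞)
    (hAB : Disjoint A B) : ∀ᵐ ω ∂P, M (A ∪ B) ω = M A ω + M B ω := by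
  set C : ℕ → Set E := fun n => if n = 0 then A else if n = 1 then B else ∅ with hC
  have hU : ⋃ n, C n = A ∪ B := by
    ext x
    simp only [hC, Set.mem_iUnion, Set.mem_union]
    constructor
    · rintro ⟨n, hn⟩
      split_ifs at hn
      exacts [Or.inl hn, Or.inr hn, hn.elim]
    · rintro (h | h)
      exacts [⟨0, by simpa using h⟩, ⟨1, by simpa using h⟩]
  have h := hM.sigma_additive C (fun n => by simp only [hC]; split_ifs <;> simp [hA, hB])
    (by rw [hU]; exact (measure_union_le _ _).trans_lt (ENNReal.add_lt_top.2 ⟨hmA, hmB⟩))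
    (fun i j hij => by
      simp only [hC]
      split_ifs with h1 h2 h3 h4 h5 <;>
        first | exact hAB | exact hAB.symm | exact disjoint_bot_left | exact disjoint_bot_right |
          omega)
  filter_upwards [h, hM.empty_ae_eq] with ω hω h0
  rw [hU] at hω
  refine tendsto_nhds_unique ((tendsto_add_atTop_iff_nat 2).2 hω) ?_
  have : ∀ n, ∑ i ∈ Finset.range (n + 2), M (C i) ω = M A ω + M B ω := by
    intro n
    induction n with
    | zero => simp [Finset.sum_range_succ, hC]
    | succ n ih =>
      rw [show n + 1 + 2 = n + 2 + 1 by ring, Finset.sum_range_succ, ih]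
      simp [hC, h0]
  simp only [this]
  exact tendsto_const_nhds

lemma biUnion_ae_eq (hM : IsIsotropicStableRandomMeasure α m P M) {ι : Type*} (s : Finset ι)
    (A : ι → Set E) (hA : ∀ i ∈ s, MeasurableSet (A i)) (hmA : ∀ i ∈ s, m (A i) < ∞)
    (hdisj : ∀ i j, i ≠ j → Disjoint (A i) (A j)) :
    ∀ᵐ ω ∂P, M (⋃ i ∈ s, A i) ω = ∑ i ∈ s, M (A i) ω := by
  classical
  induction s using Finset.induction_on with
  | empty => simpa using hM.empty_ae_eq
  | insert a s ha ih =>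
    have h1 := ih (fun i hi => hA i (Finset.mem_insert_of_mem hi))
      (fun i hi => hmA i (Finset.mem_insert_of_mem hi))
    have h2 := hM.union_ae_eq (hA a (Finset.mem_insert_self a s))
      (Finset.measurableSet_biUnion s fun i hi => hA i (Finset.mem_insert_of_mem hi))
      (hmA a (Finset.mem_insert_self a s))
      ((measure_biUnion_finset_le s A).trans_lt
        (ENNReal.sum_lt_top.2 fun i hi => hmA i (Finset.mem_insert_of_mem hi)))
      (Set.disjoint_iUnion₂_right.2 fun i hi => hdisj a i (fun h => ha (h ▸ hi)))
    filter_upwards [h1, h2] with ω h1 h2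
    rw [Finset.set_biUnion_insert, h2, h1, Finset.sum_insert ha]

/-- Writes the integrals of all functions of `S`, in particular of all coordinates of a
vector-valued `S`, over the single partition given by `S`. The fibre over zero, possibly of infinite
measure, drops out since `G 0 = 0`. -/
lemma simpleStableIntegral_map_ae_eq (hM : IsIsotropicStableRandomMeasure α m P M) {F : Type*}
    [Zero F] [DecidablePred fun v : F => v ≠ 0] {S : SimpleFunc E F} (hS : S.FinMeasSupp m) {G : F → ℂ} (hG : G 0 = 0) :
    ∀ᵐ ω ∂P, simpleStableIntegral M (S.map G) ω =
      ∑ v ∈ S.range with v ≠ 0, G v * M (S ⁻¹' {v}) ω := by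
  classical
  have hc : ∀ c ∈ (S.map G).range, ∀ᵐ ω ∂P, c * M (S.map G ⁻¹' {c}) ω =
      ∑ v ∈ S.range with v ≠ 0 ∧ G v = c, G v * M (S ⁻¹' {v}) ω := by
    intro c _
    rcases eq_or_ne c 0 with rfl | hc
    · refine ae_of_all _ fun ω => ?_
      rw [zero_mul, Finset.sum_eq_zero]
      intro v hv
      rw [(Finset.mem_filter.1 hv).2.2, zero_mul]
    · have hU : S.map G ⁻¹' {c} = ⋃ v ∈ S.range.filter (fun v => v ≠ 0 ∧ G v = c), S ⁻¹' {v} := by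
        ext x
        simp only [SimpleFunc.coe_map, Set.mem_preimage, Function.comp_apply,
          Set.mem_singleton_iff, Finset.mem_filter, Set.mem_iUnion, exists_prop]
        constructor
        · intro h
          exact ⟨S x, ⟨SimpleFunc.mem_range_self S x, fun h0 => hc (by rw [← h, h0, hG]), h⟩, rfl⟩
        · rintro ⟨v, ⟨_, _, h⟩, rfl⟩
          exact h
      have h := hM.biUnion_ae_eq (S.range.filter (fun v => v ≠ 0 ∧ G v = c)) (fun v => S ⁻¹' {v})
        (fun v _ => S.measurableSet_fiber v)
        (fun v hv => hS.meas_preimage_singleton_ne_zero (Finset.mem_filter.1 hv).2.1)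
        (fun v w hvw => Disjoint.preimage _ (Set.disjoint_singleton.2 hvw))
      filter_upwards [h] with ω hω
      rw [hU, hω, Finset.mul_sum]
      refine Finset.sum_congr rfl fun v hv => ?_
      rw [(Finset.mem_filter.1 hv).2.2]
  have hall := (Finset.eventually_all (S.map G).range).2 hc
  filter_upwards [hall] with ω hω
  rw [simpleStableIntegral, Finset.sum_congr rfl hω]
  simp_rw [← Finset.filter_filter]
  refine Finset.sum_fiberwise_of_maps_to (fun v hv => ?_) _
  rw [SimpleFunc.range_map]
  exact Finset.mem_image_of_mem _ (Finset.mem_filter.1 hv).1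

lemma simpleStableIntegral_sub_ae_eq (hM : IsIsotropicStableRandomMeasure α m P M)
    {s s' : SimpleFunc E ℂ} (hs : s.FinMeasSupp m) (hs' : s'.FinMeasSupp m) :
    ∀ᵐ ω ∂P, simpleStableIntegral M (s - s') ω =
      simpleStableIntegral M s ω - simpleStableIntegral M s' ω := by
  classical
  have hp := hs.pair hs'
  have h1 := hM.simpleStableIntegral_map_ae_eq hp (G := Prod.fst) rfl
  have h2 := hM.simpleStableIntegral_map_ae_eq hp (G := Prod.snd) rfl
  have h3 := hM.simpleStableIntegral_map_ae_eq hp (G := fun p => p.1 - p.2) (by simp)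
  rw [SimpleFunc.map_fst_pair] at h1
  rw [SimpleFunc.map_snd_pair] at h2
  have h4 : (s.pair s').map (fun p => p.1 - p.2) = s - s' := rfl
  rw [h4] at h3
  filter_upwards [h1, h2, h3] with ω h1 h2 h3
  rw [h1, h2, h3, ← Finset.sum_sub_distrib]
  exact Finset.sum_congr rfl fun v _ => sub_mul _ _ _

lemma charFun_const_mul (hM : IsIsotropicStableRandomMeasure α m P M) {A : Set E}
    (hA : MeasurableSet A) (hmA : m A < ∞) (a z : ℂ) :
    charFun (P.map fun ω => a * M A ω) z =
      ((Real.exp (-(‖a‖ ^ α * (m A).toReal * ‖z‖ ^ α)) : ℝ) : ℂ) := by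
  have hmeas := hM.measurable A hA hmA
  have h : charFun (P.map fun ω => a * M A ω) z =
      charFun (P.map (M A)) (starRingEnd ℂ a * z) := by
    rw [charFun_apply, charFun_apply, integral_map (by fun_prop) (by fun_prop),
      integral_map (by fun_prop) (by fun_prop)]
    congr 1
    ext ω
    rw [Complex.inner, Complex.inner, map_mul]
    rw [show starRingEnd ℂ a * z * starRingEnd ℂ (M A ω) =
      z * (starRingEnd ℂ a * starRingEnd ℂ (M A ω)) by ring]
  rw [h, hM.charFun_eq A hA hmA, norm_mul, RCLike.norm_conj,
    Real.mul_rpow (norm_nonneg _) (norm_nonneg _)]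
  congr 3
  ring

lemma map_neg_const_mul [IsProbabilityMeasure P] (hM : IsIsotropicStableRandomMeasure α m P M)
    {A : Set E} (hA : MeasurableSet A) (hmA : m A < ∞) (a : ℂ) :
    P.map (fun ω => -(a * M A ω)) = P.map fun ω => a * M A ω := by
  have hmeas := hM.measurable A hA hmA
  have : IsProbabilityMeasure (P.map fun ω => -(a * M A ω)) :=
    Measure.isProbabilityMeasure_map (by fun_prop)
  have : IsProbabilityMeasure (P.map fun ω => a * M A ω) :=
    Measure.isProbabilityMeasure_map (by fun_prop)
  refine Measure.ext_of_charFun ?_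
  ext z
  simp_rw [← neg_mul]
  rw [hM.charFun_const_mul hA hmA, hM.charFun_const_mul hA hmA, norm_neg]

lemma iIndepFun_of_fintype (hM : IsIsotropicStableRandomMeasure α m P M) {ι : Type*} [Fintype ι]
    {A : ι → Set E} (hA : ∀ i, MeasurableSet (A i)) (hmA : ∀ i, m (A i) < ∞)
    (hdisj : ∀ i j, i ≠ j → Disjoint (A i) (A j)) : iIndepFun (fun i => M (A i)) P := by
  have e := Fintype.equivFin ι
  have h := hM.indep _ (fun i => A (e.symm i)) (fun i => hA _) (fun i => hmA _)
    (fun i j hij => hdisj _ _ (e.symm.injective.ne hij))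
  simpa using h.precomp e.injective

/-- By independence over the fibres the integral is isotropic stable with scale `‖S‖ ^ α` in `L^α`.
This yields continuity of the integral in probability. -/
lemma measureReal_norm_simpleStableIntegral_gt_le [IsProbabilityMeasure P] (hα : 0 < α)
    (hα2 : α ≤ 2) (hM : IsIsotropicStableRandomMeasure α m P M) {S : SimpleFunc E ℂ}
    (hS : S.FinMeasSupp m) {r : ℝ} (hr : 0 < r) :
    P.real {ω | r < ‖simpleStableIntegral M S ω‖} ≤
      64 * (eLpNorm S (ENNReal.ofReal α) m).toReal ^ α * r ^ (-α) := by
  classical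
  set T := S.range.filter (fun v => v ≠ 0) with hT
  have hfin : ∀ v : T, m (S ⁻¹' {v.1}) < ∞ := fun v =>
    hS.meas_preimage_singleton_ne_zero (Finset.mem_filter.1 v.2).2
  have hmeas : ∀ v : T, Measurable (M (S ⁻¹' {v.1})) := fun v =>
    hM.measurable _ (S.measurableSet_fiber _) (hfin v)
  set I : Ω → ℂ := fun ω => ∑ v : T, v.1 * M (S ⁻¹' {v.1}) ω with hI
  have hIm : Measurable I := Finset.measurable_sum _ fun v _ => (hmeas v).const_mul _
  have hind : iIndepFun (fun (v : T) ω => v.1 * M (S ⁻¹' {v.1}) ω) P :=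
    (hM.iIndepFun_of_fintype (A := fun v : T => S ⁻¹' {v.1}) (fun v => S.measurableSet_fiber _) hfin
      (fun v w hvw => Disjoint.preimage _ (Set.disjoint_singleton.2 (Subtype.coe_ne_coe.2 hvw)))).comp
      (fun v z => v.1 * z) (fun v => measurable_const_mul _)
  have hcf : ∀ z, charFun (P.map I) z = ((Real.exp
      (-((eLpNorm S (ENNReal.ofReal α) m).toReal ^ α * ‖z‖ ^ α)) : ℝ) : ℂ) := by
    intro z
    rw [hI, hind.charFun_map_fun_sum_eq_prod fun v => ((hmeas v).const_mul _).aemeasurable,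
      Finset.prod_apply]
    simp_rw [hM.charFun_const_mul (S.measurableSet_fiber _) (hfin _)]
    rw [← Complex.ofReal_prod, ← Real.exp_sum, Finset.sum_neg_distrib, ← Finset.sum_mul,
      ← SimpleFunc.sum_norm_rpow_mul_measure_eq hα hS, ← hT,
      Finset.sum_coe_sort T fun v => ‖v‖ ^ α * (m (S ⁻¹' {v})).toReal]
  have hprob : IsProbabilityMeasure (P.map I) := Measure.isProbabilityMeasure_map hIm.aemeasurable
  have htail := measureReal_norm_gt_le_of_charFun hα hα2 (by positivity) hcf hr
  rw [map_measureReal_apply hIm (measurableSet_lt measurable_const measurable_norm)] at htail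
  refine le_of_eq_of_le (measureReal_congr ?_) htail
  have hae := hM.simpleStableIntegral_map_ae_eq hS (G := id) rfl
  rw [show S.map id = S from rfl] at hae
  refine eventuallyEq_set.2 ?_
  filter_upwards [hae] with ω hω
  simp only [Set.mem_ofPred_eq, Set.mem_preimage, hω, hI, id_eq,
    Finset.sum_coe_sort T fun v => v * M (S ⁻¹' {v}) ω]
  rfl

lemma tendstoInMeasure_simpleStableIntegral_sub [IsProbabilityMeasure P] (hα : 0 < α)
    (hα2 : α ≤ 2) (hM : IsIsotropicStableRandomMeasure α m P M) {s s' : ℕ → SimpleFunc E ℂ}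
    (hs : ∀ n, (s n).FinMeasSupp m) (hs' : ∀ n, (s' n).FinMeasSupp m)
    (h : Tendsto (fun n => eLpNorm (fun x => s n x - s' n x) (ENNReal.ofReal α) m) atTop (𝓝 0)) :
    TendstoInMeasure P (fun n ω => simpleStableIntegral M (s n) ω - simpleStableIntegral M (s' n) ω)
      atTop (fun _ => 0) := by
  have hd : TendstoInMeasure P (fun n => simpleStableIntegral M (s n - s' n)) atTop
      (fun _ => (0 : ℂ)) := by
    rw [tendstoInMeasure_iff_measureReal_norm]
    intro ε hε
    have h1 : Tendsto (fun n => 64 * (eLpNorm (fun x => s n x - s' n x)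
        (ENNReal.ofReal α) m).toReal ^ α * (ε / 2) ^ (-α)) atTop (𝓝 0) := by
      have h2 := (ENNReal.tendsto_toReal ENNReal.zero_ne_top).comp h
      have h3 := (((Real.continuousAt_rpow_const _ α (Or.inr hα.le)).tendsto.comp h2).const_mul
        64).mul_const ((ε / 2) ^ (-α))
      simpa [Function.comp_def, hα.ne'] using h3
    refine squeeze_zero (fun _ => measureReal_nonneg) (fun n => ?_) h1
    rw [show (fun x => s n x - s' n x) = (s n - s' n : SimpleFunc E ℂ) from rfl]
    have hfin : (s n - s' n).FinMeasSupp m := by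
      have := (hs n).map₂ (hs' n) (op := fun a b => a - b) (by simp)
      exact this
    refine le_trans (measureReal_mono fun ω hω => ?_)
      (hM.measureReal_norm_simpleStableIntegral_gt_le hα hα2 hfin (half_pos hε))
    simp only [Set.mem_ofPred_eq, sub_zero] at hω ⊢
    linarith
  exact hd.congr_left fun n => hM.simpleStableIntegral_sub_ae_eq (hs n) (hs' n)

end IsIsotropicStableRandomMeasure

/-! ### Stable integrals of general functions and their maximal inequality. -/

section StableIntegral

variable {E Ω : Type*} [MeasurableSpace E] [MeasurableSpace Ω] {α : ℝ} {m : Measure E}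
  {P : Measure Ω} {M : Set E → Ω → ℂ}

lemma tendsto_eLpNorm_sub_of_common_limit {p : ℝ≥0∞} (hp : 1 ≤ p) {f : E → ℂ}
    (hf : Measurable f) {s s' : ℕ → SimpleFunc E ℂ}
    (hs : Tendsto (fun n => eLpNorm (fun x => s n x - f x) p m) atTop (𝓝 0))
    (hs' : Tendsto (fun n => eLpNorm (fun x => s' n x - f x) p m) atTop (𝓝 0)) :
    Tendsto (fun n => eLpNorm (fun x => s n x - s' n x) p m) atTop (𝓝 0) := by
  have h := hs.add hs'
  rw [add_zero] at h
  refine tendsto_of_tendsto_of_tendsto_of_le_of_le tendsto_const_nhds h (fun _ => zero_le)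
    fun n => ?_
  have h1 := eLpNorm_sub_le (μ := m) (p := p) (f := fun x => s n x - f x)
    (g := fun x => s' n x - f x) ((s n).measurable.sub hf).aestronglyMeasurable
    ((s' n).measurable.sub hf).aestronglyMeasurable hp
  refine le_of_eq_of_le (congrArg (eLpNorm · p m) ?_) h1
  ext x
  simp

/-- The definition provides one approximating sequence for each integrand; independence of that
choice lets one vector-valued sequence serve all integrands together. -/
lemma IsStableIntegral.tendstoInMeasure [IsProbabilityMeasure P] (hα : 1 ≤ α) (hα2 : α ≤ 2)
    (hM : IsIsotropicStableRandomMeasure α m P M) {f : E → ℂ} (hf : Measurable f) {J : Ω → ℂ}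
    (hJ : IsStableIntegral α m P M f J) {S : ℕ → SimpleFunc E ℂ} (hS : ∀ n, (S n).FinMeasSupp m)
    (hSf : Tendsto (fun n => eLpNorm (fun x => S n x - f x) (ENNReal.ofReal α) m) atTop (𝓝 0)) :
    TendstoInMeasure P (fun n => simpleStableIntegral M (S n)) atTop J := by
  obtain ⟨s, hs, hsf, hsJ⟩ := hJ
  have h := hM.tendstoInMeasure_simpleStableIntegral_sub (by linarith) hα2 hs hS
    (tendsto_eLpNorm_sub_of_common_limit (ENNReal.one_le_ofReal.2 hα) hf hsf hSf)
  simpa using hsJ.sub h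

lemma IsStableIntegral.sub (hα : 1 ≤ α) (hM : IsIsotropicStableRandomMeasure α m P M)
    {f f' : E → ℂ} (hf : Measurable f) (hf' : Measurable f') {J J' : Ω → ℂ}
    (hJ : IsStableIntegral α m P M f J) (hJ' : IsStableIntegral α m P M f' J') :
    IsStableIntegral α m P M (fun x => f x - f' x) (fun ω => J ω - J' ω) := by
  obtain ⟨s, hs, hsf, hsJ⟩ := hJ
  obtain ⟨s', hs', hsf', hsJ'⟩ := hJ'
  refine ⟨fun n => s n - s' n, fun n => ?_, ?_, ?_⟩
  · exact (hs n).map₂ (hs' n) (op := fun a b => a - b) (by simp)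
  · have h := hsf.add hsf'
    rw [add_zero] at h
    refine tendsto_of_tendsto_of_tendsto_of_le_of_le tendsto_const_nhds h (fun _ => zero_le)
      fun n => ?_
    have h1 := eLpNorm_sub_le (μ := m) (p := ENNReal.ofReal α) (f := fun x => s n x - f x)
      (g := fun x => s' n x - f' x) ((s n).measurable.sub hf).aestronglyMeasurable
      ((s' n).measurable.sub hf').aestronglyMeasurable (ENNReal.one_le_ofReal.2 hα)
    refine le_of_eq_of_le (congrArg (eLpNorm · _ m) ?_) h1
    ext x
    simp only [SimpleFunc.coe_sub, Pi.sub_apply]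
    ring
  · refine (hsJ.sub hsJ').congr_left fun n => ?_
    filter_upwards [hM.simpleStableIntegral_sub_ae_eq (hs n) (hs' n)] with ω hω
    exact hω.symm

/-- The bound on the probability that one of `N` stable integrals exceeds a level `y`, where `Q`
bounds the probability of a jump above `y`, jumps below `y / L` are compensated by symmetry, and
`θ` and `R` are the parameters of the Chernoff bound for the jumps between `y / L` and `y`. -/
noncomputable def maximalBound (α N L θ R Q : ℝ) : ℝ :=
  Q + 2 * N * Real.exp (-L + 2 / (2 - α) * (Q * L ^ α)) +
    Real.exp (-θ * R + θ * Real.exp θ * (Q * L ^ (α - 1) * (1 + Real.log L)))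

variable [IsProbabilityMeasure P] {κ : Type*} [Fintype κ]

lemma IsIsotropicStableRandomMeasure.measureReal_exists_simpleStableIntegral_gt_le
    (hM : IsIsotropicStableRandomMeasure α m P M) (hα : 1 ≤ α) (hα2 : α < 2)
    {S : SimpleFunc E (κ → ℂ)} (hS : S.FinMeasSupp m) {y L θ R Q : ℝ} (hy : 0 < y) (hL : 1 ≤ L)
    (hθ : 0 ≤ θ)
    (hQ : 64 * (eLpNorm S (ENNReal.ofReal α) m).toReal ^ α * y ^ (-α) ≤ Q) :
    P.real {ω | ∃ k, (R + 1) * y < |(simpleStableIntegral M (S.map fun v => v k) ω).re|} ≤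
      maximalBound α (Fintype.card κ) L θ R Q := by
  classical
  set T := S.range.filter (fun v => v ≠ 0) with hT
  have hfin : ∀ v : T, m (S ⁻¹' {v.1}) < ∞ := fun v =>
    hS.meas_preimage_singleton_ne_zero (Finset.mem_filter.1 v.2).2
  have hmeas : ∀ v : T, Measurable (M (S ⁻¹' {v.1})) := fun v =>
    hM.measurable _ (S.measurableSet_fiber _) (hfin v)
  -- Weighting each atom by the sup norm of the value vector leaves coefficients `v k / ‖v‖` of norm
  -- at most 1, and the tail weights add up to the `L^α` norm of the maximum over `k`.
  set Z : T → Ω → ℂ := fun v ω => ((‖v.1‖ : ℝ) : ℂ) * M (S ⁻¹' {v.1}) ω with hZdef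
  have hZ : ∀ v, Measurable (Z v) := fun v => (hmeas v).const_mul _
  have hind : iIndepFun Z P :=
    (hM.iIndepFun_of_fintype (A := fun v : T => S ⁻¹' {v.1}) (fun v => S.measurableSet_fiber _) hfin
      (fun v w hvw => Disjoint.preimage _ (Set.disjoint_singleton.2 (Subtype.coe_ne_coe.2 hvw)))).comp
      (fun v z => ((‖v.1‖ : ℝ) : ℂ) * z) (fun v => measurable_const_mul _)
  have htail : ∀ (v : T) x, 0 < x → P.real {ω | x < ‖Z v ω‖} ≤
      64 * (‖v.1‖ ^ α * (m (S ⁻¹' {v.1})).toReal) * x ^ (-α) := by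
    intro v x hx
    have hprob : IsProbabilityMeasure (P.map (Z v)) :=
      Measure.isProbabilityMeasure_map (hZ v).aemeasurable
    have h := measureReal_norm_gt_le_of_charFun (μ := P.map (Z v)) (α := α)
      (σ := ‖v.1‖ ^ α * (m (S ⁻¹' {v.1})).toReal) (by linarith) hα2.le (by positivity) (fun z => by
        rw [hZdef, hM.charFun_const_mul (S.measurableSet_fiber _) (hfin v), Complex.norm_real,
          norm_norm]) hx
    rwa [map_measureReal_apply (hZ v) (measurableSet_lt measurable_const measurable_norm)] at h
  have hQ' : (∑ v : T, 64 * (‖v.1‖ ^ α * (m (S ⁻¹' {v.1})).toReal)) * y ^ (-α) ≤ Q := by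
    rw [← Finset.mul_sum, Finset.sum_coe_sort T fun v => ‖v‖ ^ α * (m (S ⁻¹' {v})).toReal, hT,
      SimpleFunc.sum_norm_rpow_mul_measure_eq (by linarith) hS]
    exact hQ
  have hmain := measureReal_exists_re_sum_gt_le (κ := κ) (R := R) hα hα2 hZ hind
    (fun v => hM.map_neg_const_mul (S.measurableSet_fiber _) (hfin v) _)
    (fun v => by positivity) htail (c := fun k v => v.1 k / ((‖v.1‖ : ℝ) : ℂ)) (fun k v => by
      rw [norm_div, Complex.norm_real, norm_norm]
      exact div_le_one_of_le₀ (norm_le_pi_norm _ k) (norm_nonneg _)) hy hL hθ hQ'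
  refine le_of_eq_of_le (measureReal_congr (eventuallyEq_set.2 ?_)) hmain
  have hae : ∀ᵐ ω ∂P, ∀ k, simpleStableIntegral M (S.map fun v => v k) ω =
      ∑ v ∈ T, v k * M (S ⁻¹' {v}) ω :=
    ae_all_iff.2 fun k => hM.simpleStableIntegral_map_ae_eq hS (G := fun v => v k) rfl
  filter_upwards [hae] with ω hω
  simp only [hω]
  refine exists_congr fun k => ?_
  rw [← Finset.sum_coe_sort T fun v => v k * M (S ⁻¹' {v}) ω]
  have : ∀ v : T, v.1 k / ((‖v.1‖ : ℝ) : ℂ) * Z v ω = v.1 k * M (S ⁻¹' {v.1}) ω := by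
    intro v
    have hv : ((‖v.1‖ : ℝ) : ℂ) ≠ 0 :=
      Complex.ofReal_ne_zero.2 (norm_ne_zero_iff.2 (Finset.mem_filter.1 v.2).2)
    simp only [hZdef]
    field_simp
  simp only [this]

theorem IsIsotropicStableRandomMeasure.measureReal_exists_stableIntegral_gt_le
    (hM : IsIsotropicStableRandomMeasure α m P M) (hα : 1 ≤ α) (hα2 : α < 2)
    {f : κ → E → ℂ} (hf : ∀ k, Measurable (f k)) {J : κ → Ω → ℂ}
    (hJ : ∀ k, IsStableIntegral α m P M (f k) (J k)) {a : ℝ} (ha : 0 ≤ a)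
    (hfa : eLpNorm (fun x k => f k x) (ENNReal.ofReal α) m ≤ ENNReal.ofReal a)
    {y L θ R Q : ℝ} (hy : 0 < y) (hL : 1 ≤ L) (hθ : 0 ≤ θ)
    (hQ : 64 * (2 * a) ^ α * y ^ (-α) ≤ Q) :
    P.real {ω | ∃ k, (R + 2) * y < |(J k ω).re|} ≤ maximalBound α (Fintype.card κ) L θ R Q := by
  have hα0 : 0 < α := by linarith
  have hp0 : ENNReal.ofReal α ≠ 0 := by simpa using hα0
  set F : E → κ → ℂ := fun x k => f k x with hF
  have hFm : Measurable F := measurable_pi_lambda _ hf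
  have hFL : MemLp F (ENNReal.ofReal α) m :=
    ⟨hFm.aestronglyMeasurable, hfa.trans_lt ENNReal.ofReal_lt_top⟩
  -- Approximating from the base point 0 gives `‖S n x‖ ≤ 2 * ‖F x‖`, the source of the factor in `2
  -- * a`.
  set S : ℕ → SimpleFunc E (κ → ℂ) := SimpleFunc.approxOn F hFm (Set.range F ∪ {0}) 0 (by simp)
    with hSdef
  have hSL : ∀ n, MemLp (S n) (ENNReal.ofReal α) m :=
    fun n => SimpleFunc.memLp_approxOn_range hFm hFL n
  have hSfin : ∀ n, (S n).FinMeasSupp m := fun n =>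
    (SimpleFunc.memLp_iff_finMeasSupp hp0 ENNReal.ofReal_ne_top).1 (hSL n)
  have hSF : Tendsto (fun n => eLpNorm (⇑(S n) - F) (ENNReal.ofReal α) m) atTop (𝓝 0) :=
    SimpleFunc.tendsto_approxOn_range_Lp_eLpNorm ENNReal.ofReal_ne_top hFm hFL.2
  have hSa : ∀ n, (eLpNorm (S n) (ENNReal.ofReal α) m).toReal ≤ 2 * a := by
    intro n
    refine ENNReal.toReal_le_of_le_ofReal (by positivity) ?_
    have h1 : eLpNorm (S n) (ENNReal.ofReal α) m ≤
        ENNReal.ofReal 2 * eLpNorm F (ENNReal.ofReal α) m := by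
      refine eLpNorm_le_mul_eLpNorm_of_ae_le_mul (ae_of_all _ fun x => ?_) _
      have := SimpleFunc.norm_approxOn_zero_le hFm (s := Set.range F ∪ {0}) (by simp) x n
      linarith
    rw [ENNReal.ofReal_mul (by norm_num)]
    exact h1.trans (by gcongr)
  have hconv : ∀ k, TendstoInMeasure P
      (fun n => simpleStableIntegral M ((S n).map fun v => v k)) atTop (J k) := by
    intro k
    refine (hJ k).tendstoInMeasure hα hα2.le hM (hf k) (fun n => (hSfin n).map rfl) ?_
    refine tendsto_of_tendsto_of_tendsto_of_le_of_le tendsto_const_nhds hSF (fun _ => zero_le)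
      fun n => ?_
    exact eLpNorm_mono fun x => norm_le_pi_norm (S n x - F x) k
  -- The approximation error is allowed one further `y`, which turns `R + 1` into `R + 2`; its
  -- probability vanishes in the limit.
  have hsum : Tendsto (fun n => maximalBound α (Fintype.card κ) L θ R Q +
      ∑ k, P.real {ω | y ≤ ‖simpleStableIntegral M ((S n).map fun v => v k) ω - J k ω‖}) atTop
      (𝓝 (maximalBound α (Fintype.card κ) L θ R Q + ∑ _k : κ, 0)) :=
    tendsto_const_nhds.add (tendsto_finsetSum _ fun k _ =>
      tendstoInMeasure_iff_measureReal_norm.1 (hconv k) y hy)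
  rw [Finset.sum_const_zero, add_zero] at hsum
  refine ge_of_tendsto' hsum fun n => ?_
  have hsimple := hM.measureReal_exists_simpleStableIntegral_gt_le hα hα2 (hSfin n) (R := R)
    hy hL hθ (le_trans (by gcongr; exact hSa n) hQ)
  have hunion := measureReal_iUnion_fintype_le (μ := P)
    (fun k => {ω | y ≤ ‖simpleStableIntegral M ((S n).map fun v => v k) ω - J k ω‖})
  refine le_trans (measureReal_mono (μ := P) ?_) ((measureReal_union_le _ _).trans
    (add_le_add hsimple hunion))
  rintro ω ⟨k, hk⟩
  by_contra hcon
  simp only [Set.mem_union, Set.mem_iUnion, Set.mem_ofPred_eq, not_or, not_exists, not_le,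
    not_lt] at hcon
  have h1 := hcon.1 k
  have h2 := (Complex.abs_re_le_norm _).trans_lt (hcon.2 k)
  rw [Complex.sub_re, abs_sub_comm] at h2
  have h3 := abs_sub_abs_le_abs_sub (J k ω).re
    (simpleStableIntegral M ((S n).map fun v => v k) ω).re
  linarith

end StableIntegral

/-! ### The common envelope of the kernel increments and its scaling. -/

section Kernel

/-- A bound for `|f_t - f_s|` when `|t - s| ≤ h`, where `f_t` is the kernel of the harmonizable
fractional stable motion. -/
noncomputable def hfsmEnvelope (H α h ξ : ℝ) : ℝ :=
  min 2 (h * |ξ|) * |ξ| ^ (-(H + 1 / α))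

lemma hfsmEnvelope_nonneg {H α h : ℝ} (hh : 0 ≤ h) (ξ : ℝ) : 0 ≤ hfsmEnvelope H α h ξ := by
  unfold hfsmEnvelope
  positivity

lemma measurable_hfsmEnvelope (H α h : ℝ) : Measurable (hfsmEnvelope H α h) := by
  unfold hfsmEnvelope
  fun_prop

lemma measurable_hfsmKernel (H α t : ℝ) : Measurable (hfsmKernel H α t) := by
  unfold hfsmKernel
  fun_prop

lemma norm_hfsmKernel_sub_le {H α h t s : ℝ} (hts : |t - s| ≤ h) (ξ : ℝ) :
    ‖hfsmKernel H α t ξ - hfsmKernel H α s ξ‖ ≤ hfsmEnvelope H α h ξ := by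
  have e : ∀ t : ℝ, Complex.I * (t : ℂ) * (ξ : ℂ) = Complex.I * ((t * ξ : ℝ) : ℂ) := fun t => by
    push_cast
    ring
  rw [hfsmKernel, hfsmKernel, ← sub_div, sub_sub_sub_cancel_right, norm_div, Complex.norm_real,
    Real.norm_of_nonneg (by positivity), hfsmEnvelope, Real.rpow_neg (abs_nonneg ξ), div_eq_mul_inv]
  gcongr
  rw [e, e]
  refine le_min ?_ ?_
  · refine (norm_sub_le _ _).trans ?_
    rw [Complex.norm_exp_I_mul_ofReal, Complex.norm_exp_I_mul_ofReal]
    norm_num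
  · have h1 : Complex.exp (Complex.I * ((t * ξ : ℝ) : ℂ)) - Complex.exp (Complex.I * ((s * ξ : ℝ) : ℂ))
        = Complex.exp (Complex.I * ((s * ξ : ℝ) : ℂ)) *
          (Complex.exp (Complex.I * (((t - s) * ξ : ℝ) : ℂ)) - 1) := by
      rw [mul_sub, mul_one, ← Complex.exp_add]
      congr 2
      push_cast
      ring
    rw [h1, norm_mul, Complex.norm_exp_I_mul_ofReal, one_mul]
    refine Real.norm_exp_I_mul_ofReal_sub_one_le.trans ?_
    rw [Real.norm_eq_abs, abs_mul]
    gcongr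

/-- The `α`-th power is of order `|ξ| ^ (α * (1 - H) - 1)` near zero, integrable as `H < 1`, and
`|ξ| ^ (-(H * α + 1))` at infinity, integrable as `H > 0`. -/
lemma memLp_hfsmEnvelope_one {H α : ℝ} (hH : 0 < H) (hH1 : H < 1) (hα : 0 < α) :
    MemLp (hfsmEnvelope H α 1) (ENNReal.ofReal α) := by
  have hp0 : ENNReal.ofReal α ≠ 0 := by simpa using hα
  rw [← integrable_norm_rpow_iff (measurable_hfsmEnvelope H α 1).aestronglyMeasurable hp0
    ENNReal.ofReal_ne_top, ENNReal.toReal_ofReal hα.le]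
  set G : ℝ → ℝ := fun ξ => ‖hfsmEnvelope H α 1 ξ‖ ^ α with hG
  have hGm : Measurable G := (measurable_hfsmEnvelope H α 1).norm.pow_const α
  have heven : ∀ ξ, G (-ξ) = G ξ := fun ξ => by simp [hG, hfsmEnvelope]
  have heq : ∀ ξ, 0 < ξ → G ξ = min 2 ξ ^ α * ξ ^ (-(H * α + 1)) := by
    intro ξ hξ
    simp only [hG]
    rw [Real.norm_of_nonneg (hfsmEnvelope_nonneg zero_le_one ξ), hfsmEnvelope, abs_of_pos hξ, one_mul,
      Real.mul_rpow (le_min zero_le_two hξ.le) (by positivity), ← Real.rpow_mul hξ.le]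
    congr 2
    field_simp
  have h01 : IntegrableOn G (Set.Ioc 0 1) := by
    have hint : IntegrableOn (fun ξ : ℝ => ξ ^ (α * (1 - H) - 1)) (Set.Ioc 0 1) := by
      rw [← intervalIntegrable_iff_integrableOn_Ioc_of_le zero_le_one]
      exact intervalIntegral.intervalIntegrable_rpow' (by nlinarith)
    refine Integrable.mono' hint hGm.aestronglyMeasurable ?_
    filter_upwards [ae_restrict_mem measurableSet_Ioc] with ξ hξ
    rw [Real.norm_of_nonneg (by positivity), heq ξ hξ.1,
      show α * (1 - H) - 1 = α + -(H * α + 1) by ring, Real.rpow_add hξ.1]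
    have := hξ.1
    gcongr
    exact min_le_right _ _
  have h1 : IntegrableOn G (Set.Ioi 1) := by
    have hint : IntegrableOn (fun ξ : ℝ => 2 ^ α * ξ ^ (-(H * α + 1))) (Set.Ioi 1) :=
      (integrableOn_Ioi_rpow_of_lt (by nlinarith [mul_pos hH hα]) one_pos).const_mul _
    refine Integrable.mono' hint hGm.aestronglyMeasurable ?_
    filter_upwards [ae_restrict_mem measurableSet_Ioi] with ξ hξ
    have hξ0 : 0 < ξ := one_pos.trans hξ
    rw [Real.norm_of_nonneg (by positivity), heq ξ hξ0]
    gcongr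
    exact min_le_left _ _
  have hpos : IntegrableOn G (Set.Ioi 0) := by
    rw [← Set.Ioc_union_Ioi_eq_Ioi zero_le_one]
    exact h01.union h1
  have hneg : IntegrableOn G (Set.Iio 0) := by
    have h := (Measure.measurePreserving_neg (volume : Measure ℝ)).integrableOn_comp_preimage
      (MeasurableEquiv.neg ℝ).measurableEmbedding (f := G) (s := Set.Ioi 0)
    have h2 := h.2 hpos
    rw [show G ∘ Neg.neg = G from funext heven] at h2
    simpa using h2
  have hall : IntegrableOn G (Set.Iio 0 ∪ Set.Ici 0) :=
    hneg.union ((integrableOn_Ici_iff_integrableOn_Ioi (by simp)).2 hpos)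
  rwa [Set.Iio_union_Ici, integrableOn_univ] at hall

/-- Self-similarity: the envelope at `h` is `h ^ (H + 1 / α)` times the dilation by `h` of the
envelope at 1, and the dilation costs `h ^ (-(1 / α))` in `L^α`. -/
lemma eLpNorm_hfsmEnvelope {H α h : ℝ} (hα : 0 < α) (hh : 0 < h) :
    eLpNorm (hfsmEnvelope H α h) (ENNReal.ofReal α) volume =
      ENNReal.ofReal (h ^ H) * eLpNorm (hfsmEnvelope H α 1) (ENNReal.ofReal α) volume := by
  have hscale : hfsmEnvelope H α h =
      fun ξ => h ^ (H + 1 / α) * hfsmEnvelope H α 1 (h * ξ) := by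
    ext ξ
    rw [hfsmEnvelope, hfsmEnvelope, abs_mul, abs_of_pos hh, one_mul,
      Real.mul_rpow hh.le (abs_nonneg _), Real.rpow_neg hh.le]
    field_simp
  have hm := (measurable_hfsmEnvelope H α 1)
  have hcomp : eLpNorm (fun ξ => hfsmEnvelope H α 1 (h * ξ)) (ENNReal.ofReal α) volume =
      ENNReal.ofReal (h ^ (-(1 / α))) *
        eLpNorm (hfsmEnvelope H α 1) (ENNReal.ofReal α) volume := by
    have h1 := eLpNorm_map_measure (μ := (volume : Measure ℝ)) (p := ENNReal.ofReal α)
      (f := fun ξ => h * ξ) (g := hfsmEnvelope H α 1) hm.aestronglyMeasurable (by fun_prop)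
    rw [Real.map_volume_mul_left hh.ne', eLpNorm_smul_measure_of_ne_top ENNReal.ofReal_ne_top,
      one_div, ENNReal.toReal_inv, ENNReal.toReal_ofReal hα.le, abs_of_pos (inv_pos.2 hh)] at h1
    rw [show (fun ξ => hfsmEnvelope H α 1 (h * ξ)) = hfsmEnvelope H α 1 ∘ fun ξ => h * ξ from rfl,
      ← h1, smul_eq_mul, ENNReal.ofReal_rpow_of_pos (inv_pos.2 hh), Real.inv_rpow hh.le,
      Real.rpow_neg hh.le, one_div]
  rw [hscale, show (fun ξ => h ^ (H + 1 / α) * hfsmEnvelope H α 1 (h * ξ)) =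
    h ^ (H + 1 / α) • fun ξ => hfsmEnvelope H α 1 (h * ξ) from rfl, eLpNorm_const_smul, hcomp,
    ← mul_assoc, Real.enorm_of_nonneg (by positivity), ← ENNReal.ofReal_mul (by positivity),
    ← Real.rpow_add hh]
  congr 3
  ring

lemma exists_eLpNorm_hfsmEnvelope_le {H α : ℝ} (hH : 0 < H) (hH1 : H < 1) (hα : 0 < α) :
    ∃ C : ℝ, 0 ≤ C ∧ ∀ h : ℝ, 0 < h →
      eLpNorm (hfsmEnvelope H α h) (ENNReal.ofReal α) volume ≤ ENNReal.ofReal (C * h ^ H) := by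
  have hfin := (memLp_hfsmEnvelope_one hH hH1 hα).2
  refine ⟨(eLpNorm (hfsmEnvelope H α 1) (ENNReal.ofReal α) volume).toReal, ENNReal.toReal_nonneg,
    fun h hh => ?_⟩
  rw [eLpNorm_hfsmEnvelope hα hh, ENNReal.ofReal_mul ENNReal.toReal_nonneg,
    ENNReal.ofReal_toReal hfin.ne, mul_comm]

end Kernel

/-! ### Choice of the parameters making the maximal bound summable. -/

section Summability

lemma summable_two_pow_mul_exp {α a K A : ℝ} {N : ℕ → ℝ} (ha : α < a + 1)
    (hN0 : ∀ n, 0 ≤ N n) (hN : ∀ n, N n ≤ A * 2 ^ n) :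
    Summable fun n : ℕ => 2 * N n *
      Real.exp (-(3 * n) + 2 / (2 - α) * (K * (n : ℝ) ^ (-a) * (3 * n) ^ α)) := by
  have hgeo : Summable fun n : ℕ => 2 * A * (2 * Real.exp (-2)) ^ n := by
    refine (summable_geometric_of_lt_one (by positivity) ?_).mul_left _
    have h := Real.add_one_le_exp 2
    rw [Real.exp_neg]
    rw [mul_inv_lt_iff₀ (Real.exp_pos _)]
    linarith
  refine hgeo.of_norm_bounded_eventually_nat ?_
  -- Since `α < a + 1`, the variance term is `o(n)`. It uses up at most one of the three `n` in the
  -- exponent, leaving the geometric ratio `2 * exp (-2) < 1`.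
  have hlim : Tendsto (fun n : ℕ => 2 / (2 - α) * K * 3 ^ α * (n : ℝ) ^ (-(a + 1 - α))) atTop
      (𝓝 0) := by
    have := ((tendsto_rpow_neg_atTop (y := a + 1 - α) (by linarith)).comp
      tendsto_natCast_atTop_atTop).const_mul (2 / (2 - α) * K * 3 ^ α)
    simpa [Function.comp_def] using this
  filter_upwards [hlim.eventually_le_const (zero_lt_one' ℝ), eventually_gt_atTop 0] with n hn hn0
  have hn0' : (0 : ℝ) < n := by exact_mod_cast hn0
  have hA : 0 ≤ A * 2 ^ n := (hN0 n).trans (hN n)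
  have h1 : 2 / (2 - α) * (K * (n : ℝ) ^ (-a) * (3 * n) ^ α) ≤ n := by
    have h2 : (n : ℝ) ^ (-(a + 1 - α)) * n = (n : ℝ) ^ (-a) * (n : ℝ) ^ α := by
      rw [← Real.rpow_add hn0', ← Real.rpow_add_one hn0'.ne']
      congr 1
      ring
    calc _ = 2 / (2 - α) * K * 3 ^ α * ((n : ℝ) ^ (-a) * (n : ℝ) ^ α) := by
          rw [Real.mul_rpow (by norm_num) hn0'.le]
          ring
      _ = (2 / (2 - α) * K * 3 ^ α * (n : ℝ) ^ (-(a + 1 - α))) * n := by rw [← h2]; ring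
      _ ≤ 1 * n := by gcongr
      _ = n := one_mul _
  have h3 := hN0 n
  rw [Real.norm_of_nonneg (by positivity)]
  calc _ ≤ 2 * (A * 2 ^ n) * Real.exp (n * (-2)) := by
        gcongr
        · exact hN n
        · linarith
    _ = _ := by rw [Real.exp_nat_mul, mul_pow]; ring

lemma summable_exp_log {α a K ε : ℝ} (hε : 0 < ε) (ha : α - 1 - a + 2 * ε < 0) (hK : 0 ≤ K) :
    Summable fun n : ℕ => Real.exp (-(ε * Real.log n) * (2 / ε) +
      ε * Real.log n * Real.exp (ε * Real.log n) *
        (K * (n : ℝ) ^ (-a) * (3 * n) ^ (α - 1) * (1 + Real.log (3 * n)))) := by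
  have hsum : Summable fun n : ℕ => Real.exp 1 * (n : ℝ) ^ (-2 : ℝ) :=
    (Real.summable_nat_rpow.2 (by norm_num)).mul_left _
  refine hsum.of_norm_bounded_eventually_nat ?_
  -- Of the two powers `n ^ ε`, one is `exp θ` and the other absorbs the two logarithms.
  set b : ℝ := -(α - 1 - a + 2 * ε) with hb
  have hlim : Tendsto (fun n : ℕ => 3 * (ε * (K * 3 ^ (α - 1)) * (2 / ε) ^ 2) * (n : ℝ) ^ (-b)) atTop
      (𝓝 0) := by
    have := ((tendsto_rpow_neg_atTop (y := b) (by linarith)).comp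
      tendsto_natCast_atTop_atTop).const_mul (3 * (ε * (K * 3 ^ (α - 1)) * (2 / ε) ^ 2))
    simpa [Function.comp_def] using this
  filter_upwards [hlim.eventually_le_const (zero_lt_one' ℝ), eventually_ge_atTop 3] with n hn hn3
  have hn3' : (3 : ℝ) ≤ n := by exact_mod_cast hn3
  have hn0 : (0 : ℝ) < n := by linarith
  have hlog1 : 1 ≤ Real.log n := by
    rw [Real.le_log_iff_exp_le hn0]
    linarith [Real.exp_one_lt_d9]
  have hlog3 : 1 + Real.log (3 * n) ≤ 3 * Real.log n := by
    rw [Real.log_mul (by norm_num) hn0.ne']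
    linarith [Real.log_le_log (by norm_num) hn3']
  have hexp : Real.exp (ε * Real.log n) = (n : ℝ) ^ ε := by
    rw [Real.rpow_def_of_pos hn0, mul_comm]
  have hlogle : Real.log n ≤ (2 / ε) * (n : ℝ) ^ (ε / 2) := by
    refine (Real.log_le_rpow_div hn0.le (half_pos hε)).trans (le_of_eq ?_)
    field_simp
  have hlog0 : 0 ≤ Real.log n := by linarith
  have hsq : Real.log n * Real.log n ≤ (2 / ε) ^ 2 * (n : ℝ) ^ ε := by
    calc _ ≤ ((2 / ε) * (n : ℝ) ^ (ε / 2)) * ((2 / ε) * (n : ℝ) ^ (ε / 2)) := by gcongr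
      _ = (2 / ε) ^ 2 * ((n : ℝ) ^ (ε / 2) * (n : ℝ) ^ (ε / 2)) := by ring
      _ = _ := by rw [← Real.rpow_add hn0, add_halves]
  have hpow : (n : ℝ) ^ (-b) = (n : ℝ) ^ ε * (n : ℝ) ^ ε * (n : ℝ) ^ (-a) * (n : ℝ) ^ (α - 1) := by
    rw [← Real.rpow_add hn0, ← Real.rpow_add hn0, ← Real.rpow_add hn0]
    congr 1
    rw [hb]
    ring
  have hD : ε * Real.log n * Real.exp (ε * Real.log n) *
        (K * (n : ℝ) ^ (-a) * (3 * n) ^ (α - 1) * (1 + Real.log (3 * n))) ≤ 1 := by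
    refine le_trans ?_ hn
    calc _ ≤ ε * Real.log n * (n : ℝ) ^ ε *
        (K * (n : ℝ) ^ (-a) * (3 * n) ^ (α - 1) * (3 * Real.log n)) := by
          rw [hexp]
          gcongr
      _ = 3 * (ε * (K * 3 ^ (α - 1)) * (Real.log n * Real.log n)) *
          ((n : ℝ) ^ ε * (n : ℝ) ^ (-a) * (n : ℝ) ^ (α - 1)) := by
          rw [Real.mul_rpow (by norm_num) hn0.le]
          ring
      _ ≤ 3 * (ε * (K * 3 ^ (α - 1)) * ((2 / ε) ^ 2 * (n : ℝ) ^ ε)) *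
          ((n : ℝ) ^ ε * (n : ℝ) ^ (-a) * (n : ℝ) ^ (α - 1)) := by gcongr
      _ = _ := by rw [hpow]; ring
  rw [Real.norm_of_nonneg (Real.exp_pos _).le, Real.exp_add, mul_comm]
  have h2 : Real.exp (-(ε * Real.log n) * (2 / ε)) = (n : ℝ) ^ (-2 : ℝ) := by
    rw [Real.rpow_def_of_pos hn0]
    congr 1
    field_simp
  rw [h2]
  gcongr

lemma exists_summable_maximalBound {α a K A : ℝ} {N : ℕ → ℝ} (hα2 : α < 2)
    (ha : 1 < a) (hK : 0 ≤ K) (hN0 : ∀ n, 0 ≤ N n) (hN : ∀ n, N n ≤ A * 2 ^ n) :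
    ∃ ε R : ℝ, 0 ≤ ε ∧ 0 ≤ R ∧ Summable fun n : ℕ =>
      maximalBound α (N n) (3 * n) (ε * Real.log n) R (K * (n : ℝ) ^ (-a)) := by
  -- With `2 * ε = 2 - α` the condition `α - 1 - a + 2 * ε < 0` reads `1 < a`, and `R = 2 / ε` makes
  -- `θ * R = 2 * log n`.
  refine ⟨(2 - α) / 2, 2 / ((2 - α) / 2), by linarith, div_nonneg zero_le_two (by linarith), ?_⟩
  refine ((((Real.summable_nat_rpow.2 (by linarith)).mul_left K)).add
    (summable_two_pow_mul_exp (by linarith) hN0 hN)).add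
    (summable_exp_log (by linarith) (by linarith) hK)

end Summability

/-! ### Deterministic chaining from dyadic increments to a modulus of continuity. -/

section DyadicChaining

lemma summable_shifted_rpow_mul_geometric {r β : ℝ} (hr0 : 0 ≤ r) (hr1 : r < 1) :
    Summable fun i : ℕ => r ^ (i + 1) * ((i : ℝ) + 2) ^ β := by
  have h := (summable_nat_add_iff 2).2 (summable_pow_mul_geometric_of_norm_lt_one ⌈β⌉₊
    (r := r) (by rwa [Real.norm_of_nonneg hr0]))
  rcases hr0.eq_or_lt with rfl | hr
  · simp
  refine Summable.of_nonneg_of_le (fun i => by positivity) (fun i => ?_) (h.mul_left r⁻¹)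
  have h1 : ((i : ℝ) + 2) ^ β ≤ ((i : ℝ) + 2) ^ ⌈β⌉₊ := by
    rw [← Real.rpow_natCast]
    exact Real.rpow_le_rpow_of_exponent_le (by linarith [Nat.cast_nonneg (α := ℝ) i]) (Nat.le_ceil β)
  calc _ ≤ r ^ (i + 1) * ((i : ℝ) + 2) ^ ⌈β⌉₊ := by gcongr
    _ = _ := by
      push_cast
      field_simp
      ring

lemma abs_floor_two_pow_mul_le {ρ s : ℝ} {N₀ : ℕ} (hρ : ρ ≤ N₀) (hs : s ∈ Set.Icc (-ρ) ρ) (n : ℕ) :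
    |⌊2 ^ n * s⌋| ≤ N₀ * 2 ^ n := by
  have h2 : (0 : ℝ) < 2 ^ n := by positivity
  refine abs_le.2 ⟨Int.le_floor.2 ?_, ?_⟩
  · push_cast
    nlinarith [hs.1]
  · have h : ((⌊2 ^ n * s⌋ : ℤ) : ℝ) ≤ ((N₀ * 2 ^ n : ℤ) : ℝ) := by
      push_cast
      nlinarith [hs.2, Int.floor_le (2 ^ n * s)]
    exact_mod_cast h

lemma floor_two_pow_succ_mul (s : ℝ) (n : ℕ) :
    ⌊2 ^ (n + 1) * s⌋ = 2 * ⌊2 ^ n * s⌋ ∨ ⌊2 ^ (n + 1) * s⌋ = 2 * ⌊2 ^ n * s⌋ + 1 := by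
  have h1 := Int.floor_le (2 ^ n * s)
  have h2 := Int.lt_floor_add_one (2 ^ n * s)
  have h3 : (2 : ℝ) ^ (n + 1) * s = 2 * (2 ^ n * s) := by ring
  have h4 : 2 * ⌊2 ^ n * s⌋ ≤ ⌊2 ^ (n + 1) * s⌋ := Int.le_floor.2 (by push_cast; linarith)
  have h5 : ⌊2 ^ (n + 1) * s⌋ < 2 * ⌊2 ^ n * s⌋ + 2 := Int.floor_lt.2 (by push_cast; linarith)
  omega

lemma tendsto_floor_two_pow_mul_div (s : ℝ) :
    Tendsto (fun n : ℕ => (⌊2 ^ n * s⌋ : ℝ) / 2 ^ n) atTop (𝓝 s) := by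
  have h0 : Tendsto (fun n : ℕ => (1 / 2 : ℝ) ^ n) atTop (𝓝 0) :=
    tendsto_pow_atTop_nhds_zero_of_lt_one (by norm_num) (by norm_num)
  refine tendsto_of_tendsto_of_dist (tendsto_const_nhds (x := s)) (squeeze_zero
    (fun _ => dist_nonneg) (fun n => ?_) h0)
  have h2 : (0 : ℝ) < 2 ^ n := by positivity
  have h1 := Int.floor_le (2 ^ n * s)
  have h3 := Int.lt_floor_add_one (2 ^ n * s)
  rw [Real.dist_eq, one_div, inv_pow, ← one_div, le_div_iff₀ h2, ← abs_of_pos h2, ← abs_mul,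
    abs_of_pos h2, sub_mul, div_mul_cancel₀ _ h2.ne', abs_of_nonneg] <;> linarith

variable {x : ℝ → ℝ} {ρ C H β : ℝ} {N₀ n₀ : ℕ}

/-- Telescoping along the binary truncations of `s`: consecutive ones coincide or are neighbours on
the finer grid, and continuity identifies the limit. -/
lemma abs_sub_floor_le_of_dyadic (hx : Continuous x) (hC : 0 ≤ C) (hH : 0 < H) (hβ : 0 ≤ β)
    (hρ : ρ ≤ N₀)
    (hd : ∀ n ≥ n₀, ∀ k : ℤ, |k| ≤ N₀ * 2 ^ n →
      |x ((k + 1) / 2 ^ n) - x (k / 2 ^ n)| ≤ C * (((1 / 2 : ℝ) ^ n) ^ H * (n : ℝ) ^ β))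
    {s : ℝ} (hs : s ∈ Set.Icc (-ρ) ρ) {n : ℕ} (hn : n₀ ≤ n) (hn1 : 1 ≤ n) :
    |x s - x (⌊2 ^ n * s⌋ / 2 ^ n)| ≤
      C * (∑' i : ℕ, ((1 / 2 : ℝ) ^ H) ^ (i + 1) * ((i : ℝ) + 2) ^ β) *
        (((1 / 2 : ℝ) ^ n) ^ H * (n : ℝ) ^ β) := by
  set u : ℕ → ℝ := fun p => x (⌊2 ^ p * s⌋ / 2 ^ p) with hu
  set b : ℕ → ℝ := fun i => ((1 / 2 : ℝ) ^ H) ^ (i + 1) * ((i : ℝ) + 2) ^ β with hb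
  have hr1 : (1 / 2 : ℝ) ^ H < 1 := Real.rpow_lt_one (by norm_num) (by norm_num) hH
  have hbs : Summable b := summable_shifted_rpow_mul_geometric (by positivity) hr1
  have hb0 : ∀ i, 0 ≤ b i := fun i => by positivity
  have hn1' : (1 : ℝ) ≤ n := by exact_mod_cast hn1
  have hstep : ∀ i, |u (n + (i + 1)) - u (n + i)| ≤
      C * (((1 / 2 : ℝ) ^ n) ^ H * (n : ℝ) ^ β) * b i := by
    intro i
    have h2 : (2 * ⌊2 ^ (n + i) * s⌋ : ℝ) / 2 ^ (n + i + 1) = ⌊2 ^ (n + i) * s⌋ / 2 ^ (n + i) := by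
      rw [pow_succ]
      field_simp
    have hk : |2 * ⌊2 ^ (n + i) * s⌋| ≤ N₀ * 2 ^ (n + i + 1) := by
      rw [abs_mul, abs_two, pow_succ]
      linarith [abs_floor_two_pow_mul_le hρ hs (n + i)]
    have h3 := hd (n + i + 1) (by omega) _ hk
    push_cast at h3
    rw [h2] at h3
    have h4 : |u (n + (i + 1)) - u (n + i)| ≤
        C * (((1 / 2 : ℝ) ^ (n + i + 1)) ^ H * ((n : ℝ) + i + 1) ^ β) := by
      simp only [hu]
      rw [← add_assoc]
      rcases floor_two_pow_succ_mul s (n + i) with h | h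
      · rw [h]
        push_cast
        rw [h2, sub_self, abs_zero]
        positivity
      · rw [h]
        push_cast
        exact h3
    refine h4.trans ?_
    -- `n + i + 1 ≤ n * (i + 2)` for `n ≥ 1` separates the scale `n` from the summation index.
    have h5 : ((n : ℝ) + i + 1) ^ β ≤ (n : ℝ) ^ β * ((i : ℝ) + 2) ^ β := by
      rw [← Real.mul_rpow (by positivity) (by positivity)]
      refine Real.rpow_le_rpow (by positivity) ?_ hβ
      nlinarith [Nat.cast_nonneg (α := ℝ) i]
    have h6 : ((1 / 2 : ℝ) ^ (n + i + 1)) ^ H =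
        ((1 / 2 : ℝ) ^ n) ^ H * ((1 / 2 : ℝ) ^ H) ^ (i + 1) := by
      rw [add_assoc, pow_add, Real.mul_rpow (by positivity) (by positivity), ← Real.rpow_natCast_mul
        (by norm_num) (i + 1) H, ← Real.rpow_mul_natCast (by norm_num) H (i + 1), mul_comm H]
    rw [h6]
    calc _ ≤ C * (((1 / 2 : ℝ) ^ n) ^ H * ((1 / 2 : ℝ) ^ H) ^ (i + 1) *
          ((n : ℝ) ^ β * ((i : ℝ) + 2) ^ β)) := by gcongr
      _ = _ := by
        simp only [hb]
        ring
  have hsumle : ∀ k, |u (n + k) - u n| ≤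
      C * (((1 / 2 : ℝ) ^ n) ^ H * (n : ℝ) ^ β) * ∑ i ∈ Finset.range k, b i := by
    intro k
    induction k with
    | zero => simp
    | succ k ih =>
      rw [Finset.sum_range_succ, mul_add]
      have := abs_sub_le (u (n + (k + 1))) (u (n + k)) (u n)
      linarith [hstep k]
  have hlim : Tendsto (fun k => |u (n + k) - u n|) atTop (𝓝 |x s - u n|) := by
    have h := (hx.tendsto s).comp (tendsto_floor_two_pow_mul_div s)
    have h' : Tendsto (fun k => u (n + k)) atTop (𝓝 (x s)) := by
      have := (tendsto_add_atTop_iff_nat n).2 h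
      simpa [Function.comp_def, hu, add_comm] using this
    exact (h'.sub_const _).abs
  refine le_of_tendsto' hlim fun k => (hsumle k).trans ?_
  calc _ ≤ C * (((1 / 2 : ℝ) ^ n) ^ H * (n : ℝ) ^ β) * ∑' i, b i := by
        gcongr
        exact hbs.sum_le_tsum _ fun i _ => hb0 i
    _ = _ := by ring

theorem exists_holder_log_bound_of_dyadic (hx : Continuous x) (hC : 0 ≤ C) (hH : 0 < H) (hβ : 0 ≤ β)
    (hρ : ρ ≤ N₀)
    (hd : ∀ n ≥ n₀, ∀ k : ℤ, |k| ≤ N₀ * 2 ^ n →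
      |x ((k + 1) / 2 ^ n) - x (k / 2 ^ n)| ≤ C * (((1 / 2 : ℝ) ^ n) ^ H * (n : ℝ) ^ β)) :
    ∃ K : ℝ, ∀ s t : ℝ, -ρ ≤ s → s < t → t ≤ ρ →
      |x t - x s| ≤ K * ((t - s) ^ H * Real.log (1 + (t - s)⁻¹) ^ β) := by
  set S : ℝ := ∑' i : ℕ, ((1 / 2 : ℝ) ^ H) ^ (i + 1) * ((i : ℝ) + 2) ^ β with hS
  have hS0 : 0 ≤ S := tsum_nonneg fun i => by positivity
  set n₁ := max n₀ 1 with hn₁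
  have hlog2 : 0 < Real.log 2 := Real.log_pos one_lt_two
  have hlogpos : ∀ h : ℝ, 0 < h → 0 < Real.log (1 + h⁻¹) := fun h hh =>
    Real.log_pos (by linarith [inv_pos.2 hh])
  obtain ⟨B, hB⟩ := (isCompact_Icc (a := -ρ) (b := ρ)).exists_bound_of_continuousOn hx.continuousOn
  set D : ℝ := ((1 / 2 : ℝ) ^ n₁) ^ H * Real.log (1 + (2 * ρ)⁻¹) ^ β with hD
  set K₁ : ℝ := C * (2 * S + 1) * (2 ^ H * (Real.log 2)⁻¹ ^ β) with hK₁
  refine ⟨max K₁ (2 * B / D), fun s t hs hst ht => ?_⟩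
  have hsI : s ∈ Set.Icc (-ρ) ρ := ⟨hs, hst.le.trans ht⟩
  have htI : t ∈ Set.Icc (-ρ) ρ := ⟨hs.trans hst.le, ht⟩
  set h : ℝ := t - s with hh
  have hh0 : 0 < h := sub_pos.2 hst
  have hlogh := hlogpos h hh0
  have hden : 0 < h ^ H * Real.log (1 + h⁻¹) ^ β := by positivity
  rcases le_or_gt h ((1 / 2 : ℝ) ^ n₁) with hsmall | hbig
  · refine le_trans ?_ (mul_le_mul_of_nonneg_right (le_max_left _ _) hden.le)
    -- The scale with `2⁻⁽ⁿ⁺¹⁾ < h ≤ 2⁻ⁿ`, at which the truncations of `s` and `t` are equal or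
    -- adjacent.
    obtain ⟨n, hn1, hn2⟩ := exists_nat_pow_near_of_lt_one hh0
      (hsmall.trans (pow_le_one₀ (by norm_num) (by norm_num))) (by norm_num : (0 : ℝ) < 1 / 2)
      (by norm_num)
    have hnn : n₁ ≤ n := by
      have := (pow_lt_pow_iff_right_of_lt_one₀ (by norm_num : (0 : ℝ) < 1 / 2) (by norm_num)).1
        (hn1.trans_le hsmall)
      omega
    have hn0 : n₀ ≤ n := (le_max_left _ _).trans hnn
    have hn01 : 1 ≤ n := (le_max_right _ _).trans hnn
    set d : ℝ := ((1 / 2 : ℝ) ^ n) ^ H * (n : ℝ) ^ β with hdd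
    have hd0 : 0 ≤ d := by positivity
    have h1 := abs_sub_floor_le_of_dyadic hx hC hH hβ hρ hd hsI hn0 hn01
    have h2 := abs_sub_floor_le_of_dyadic hx hC hH hβ hρ hd htI hn0 hn01
    rw [← hS, ← hdd] at h1 h2
    have h2n : (0 : ℝ) < 2 ^ n := by positivity
    have hpow : (1 / 2 : ℝ) ^ n * 2 ^ n = 1 := by rw [← mul_pow]; norm_num
    have h3 : |x (⌊2 ^ n * t⌋ / 2 ^ n) - x (⌊2 ^ n * s⌋ / 2 ^ n)| ≤ C * d := by
      have h4 : ⌊2 ^ n * s⌋ ≤ ⌊2 ^ n * t⌋ := Int.floor_mono (by gcongr)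
      have h5 : ⌊2 ^ n * t⌋ ≤ ⌊2 ^ n * s⌋ + 1 := by
        rw [← Int.floor_add_one]
        refine Int.floor_mono ?_
        nlinarith
      have h6 : ⌊2 ^ n * t⌋ = ⌊2 ^ n * s⌋ ∨ ⌊2 ^ n * t⌋ = ⌊2 ^ n * s⌋ + 1 := by omega
      rcases h6 with h6 | h6
      · rw [h6, sub_self, abs_zero]
        positivity
      · rw [h6]
        push_cast
        exact hd n hn0 _ (abs_floor_two_pow_mul_le hρ hsI n)
    have h7 : |x t - x s| ≤ C * (2 * S + 1) * d := by
      have h8 := abs_sub_le (x t) (x (⌊2 ^ n * t⌋ / 2 ^ n)) (x s)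
      have h9 := abs_sub_le (x (⌊2 ^ n * t⌋ / 2 ^ n)) (x (⌊2 ^ n * s⌋ / 2 ^ n)) (x s)
      rw [abs_sub_comm (x (⌊2 ^ n * s⌋ / 2 ^ n)) (x s)] at h9
      linarith
    have h10 : ((1 / 2 : ℝ) ^ n) ^ H ≤ 2 ^ H * h ^ H := by
      rw [← Real.mul_rpow (by norm_num) hh0.le]
      refine Real.rpow_le_rpow (by positivity) ?_ hH.le
      rw [pow_succ] at hn1
      linarith
    have h11 : (n : ℝ) ^ β ≤ (Real.log 2)⁻¹ ^ β * Real.log (1 + h⁻¹) ^ β := by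
      rw [← Real.mul_rpow (by positivity) hlogh.le]
      refine Real.rpow_le_rpow (by positivity) ?_ hβ
      rw [le_inv_mul_iff₀ hlog2, mul_comm, ← Real.log_pow]
      refine Real.log_le_log h2n ?_
      have : (2 : ℝ) ^ n ≤ h⁻¹ := by
        rw [le_inv_comm₀ h2n hh0, ← inv_pow, ← one_div]
        exact hn2
      linarith
    calc |x t - x s| ≤ C * (2 * S + 1) * d := h7
      _ ≤ C * (2 * S + 1) * ((2 ^ H * h ^ H) *
          ((Real.log 2)⁻¹ ^ β * Real.log (1 + h⁻¹) ^ β)) := by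
          rw [hdd]
          gcongr
      _ = _ := by rw [hK₁]; ring
  -- At larger distances boundedness on the compact interval suffices: the denominator is at least
  -- `D` because `2⁻ⁿ¹ < h ≤ 2 * ρ`.
  · refine le_trans ?_ (mul_le_mul_of_nonneg_right (le_max_right _ _) hden.le)
    have hρ0 : 0 < 2 * ρ := by linarith
    have hD0 : 0 < D := by
      have := hlogpos (2 * ρ) hρ0
      positivity
    have hDle : D ≤ h ^ H * Real.log (1 + h⁻¹) ^ β := by
      have h1 := hlogpos (2 * ρ) hρ0
      rw [hD]
      gcongr
      linarith
    have hBt := hB t htI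
    have hBs := hB s hsI
    rw [Real.norm_eq_abs] at hBt hBs
    have hB0 : 0 ≤ B := (abs_nonneg _).trans hBt
    calc |x t - x s| ≤ 2 * B := by linarith [abs_sub (x t) (x s)]
      _ = 2 * B / D * D := by field_simp
      _ ≤ _ := by gcongr

end DyadicChaining

/-! ### Borel–Cantelli for the dyadic increments. -/

section DyadicIncrements

variable {Ω : Type*} [MeasurableSpace Ω] {P : Measure Ω} [IsProbabilityMeasure P] {H α δ : ℝ}
  {M : Set ℝ → Ω → ℂ}

theorem IsIsotropicStableRandomMeasure.ae_eventually_dyadic_increment_le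
    (hM : IsIsotropicStableRandomMeasure α volume P M) (hH : 0 < H) (hH1 : H < 1) (hα : 1 ≤ α)
    (hα2 : α < 2) (hδ : 0 < δ) (N₀ : ℕ) {J : ℝ → Ω → ℂ}
    (hJ : ∀ t, IsStableIntegral α volume P M (hfsmKernel H α t) (J t)) :
    ∃ C : ℝ, 0 ≤ C ∧ ∀ᵐ ω ∂P, ∀ᶠ n : ℕ in atTop, ∀ k : ℤ, |k| ≤ N₀ * 2 ^ n →
      |(J ((k + 1) / 2 ^ n) ω).re - (J (k / 2 ^ n) ω).re| ≤
        C * (((1 / 2 : ℝ) ^ n) ^ H * (n : ℝ) ^ (1 / α + δ)) := by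
  have hα0 : 0 < α := by linarith
  set β : ℝ := 1 / α + δ with hβ
  -- This exponent exceeds 1, which makes the probability of a large jump summable in `n`.
  have hβα : β * α = 1 + α * δ := by
    rw [hβ]
    field_simp
  obtain ⟨C₀, hC₀, henv⟩ := exists_eLpNorm_hfsmEnvelope_le hH hH1 hα0
  set κ : ℕ → Finset ℤ := fun n => Finset.Icc (-(N₀ * 2 ^ n)) (N₀ * 2 ^ n) with hκ
  have hcard : ∀ n, ((Fintype.card (κ n) : ℕ) : ℝ) ≤ (2 * N₀ + 1) * 2 ^ n := by
    intro n
    have h0 : (0 : ℤ) ≤ N₀ * 2 ^ n := by positivity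
    have h1 : (Fintype.card (κ n) : ℤ) = 2 * (N₀ * 2 ^ n) + 1 := by
      rw [Fintype.card_coe, hκ, Int.card_Icc, Int.toNat_of_nonneg (by linarith)]
      ring
    have h2 : ((Fintype.card (κ n) : ℕ) : ℝ) = 2 * (N₀ * 2 ^ n) + 1 := by exact_mod_cast h1
    have h3 : (1 : ℝ) ≤ 2 ^ n := one_le_pow₀ (by norm_num)
    rw [h2]
    linarith
  obtain ⟨ε, R, hε, hR, hsum⟩ := exists_summable_maximalBound (α := α) (a := 1 + α * δ)
    (K := 64 * (2 * C₀) ^ α) hα2 (by nlinarith [mul_pos hα0 hδ]) (by positivity)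
    (fun n => Nat.cast_nonneg (Fintype.card (κ n))) hcard
  refine ⟨R + 2, by linarith, ?_⟩
  set y : ℕ → ℝ := fun n => ((1 / 2 : ℝ) ^ n) ^ H * (n : ℝ) ^ β with hy
  set A : ℕ → Set Ω := fun n => {ω | ∃ k : κ n, (R + 2) * y n <
    |(J ((k + 1) / 2 ^ n) ω - J (k / 2 ^ n) ω).re|} with hA
  have hbound : ∀ n : ℕ, 1 ≤ n → P.real (A n) ≤ maximalBound α (Fintype.card (κ n)) (3 * n)
      (ε * Real.log n) R (64 * (2 * C₀) ^ α * (n : ℝ) ^ (-(1 + α * δ))) := by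
    intro n hn
    have hn1 : (1 : ℝ) ≤ n := by exact_mod_cast hn
    have hn0 : (0 : ℝ) < n := by linarith
    have hpow : (0 : ℝ) < (1 / 2) ^ n := by positivity
    refine hM.measureReal_exists_stableIntegral_gt_le hα hα2
      (f := fun (k : κ n) ξ => hfsmKernel H α ((k + 1) / 2 ^ n) ξ - hfsmKernel H α (k / 2 ^ n) ξ)
      (fun k => (measurable_hfsmKernel _ _ _).sub (measurable_hfsmKernel _ _ _))
      (fun k => (hJ _).sub hα hM (measurable_hfsmKernel _ _ _) (measurable_hfsmKernel _ _ _) (hJ _))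
      (a := C₀ * ((1 / 2 : ℝ) ^ n) ^ H) (by positivity) ?_ (by positivity) (by linarith)
      (mul_nonneg hε (Real.log_nonneg hn1)) ?_
    · refine le_trans (eLpNorm_mono_real fun ξ => ?_) (henv ((1 / 2 : ℝ) ^ n) hpow)
      -- The envelope bounds the supremum over all `k`, so the norm does not grow with the number of
      -- increments.
      refine (pi_norm_le_iff_of_nonneg (hfsmEnvelope_nonneg hpow.le ξ)).2 fun k => ?_
      refine norm_hfsmKernel_sub_le (le_of_eq ?_) ξ
      rw [← sub_div, add_sub_cancel_left, abs_of_pos (by positivity), one_div, one_div, inv_pow]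
    -- The factors `h ^ H` of the norm and of the level `y n` cancel, leaving only `n ^ (-(β * α))`.
    · refine le_of_eq ?_
      have hz : 0 < ((1 / 2 : ℝ) ^ n) ^ H := by positivity
      rw [hy, ← mul_assoc 2, Real.mul_rpow (by positivity) hz.le,
        Real.mul_rpow hz.le (by positivity), Real.rpow_neg hz.le, ← Real.rpow_mul hn0.le,
        mul_neg, hβα]
      field_simp
  have hAsum : Summable fun n => P.real (A n) := by
    refine hsum.of_norm_bounded_eventually_nat ?_
    filter_upwards [eventually_ge_atTop 1] with n hn
    rw [Real.norm_of_nonneg measureReal_nonneg]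
    exact hbound n hn
  have hfin : ∑' n, P (A n) ≠ ∞ := by
    have h := ENNReal.ofReal_tsum_of_nonneg (fun n => measureReal_nonneg) hAsum
    rw [tsum_congr fun n => ofReal_measureReal (μ := P) (s := A n)] at h
    rw [← h]
    exact ENNReal.ofReal_ne_top
  filter_upwards [ae_eventually_notMem hfin] with ω hω
  filter_upwards [hω] with n hn k hk
  refine not_lt.1 fun hlt => hn ⟨⟨k, Finset.mem_Icc.2 (abs_le.1 hk)⟩, ?_⟩
  rwa [Complex.sub_re]

end DyadicIncrements

/-! ### The modulus of continuity of the paths. -/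

theorem mainTheorem1 {Ω : Type*} [MeasurableSpace Ω] (P : Measure Ω) [IsProbabilityMeasure P]
    (H α δ ρ : ℝ) (hH : H ∈ Set.Ioo (0 : ℝ) 1) (hα : α ∈ Set.Ico (1 : ℝ) 2)
    (hδ : 0 < δ) (hρ : 0 < ρ)
    (M : Set ℝ → Ω → ℂ) (X : ℝ → Ω → ℝ) (hX : IsHFSM H α P M X) :
    ∀ᵐ ω ∂P,
      (⨆ (t' : ℝ) (t'' : ℝ) (_ : -ρ ≤ t' ∧ t' < t'' ∧ t'' ≤ ρ),
        ENNReal.ofReal (|X t' ω - X t'' ω| /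
          (|t' - t''| ^ H * Real.log (1 + |t' - t''|⁻¹) ^ (1 / α + δ)))) < ∞ := by
  choose J hJ hXJ using hX.eq_integral
  have hα0 : 0 < α := by linarith [hα.1]
  obtain ⟨C, hC, hinc⟩ := hX.randomMeasure.ae_eventually_dyadic_increment_le hH.1 hH.2 hα.1 hα.2 hδ
    ⌈ρ⌉₊ hJ
  -- The null set on which `X t` differs from its integral depends on `t`; only the countably many
  -- dyadic points are needed.
  have hdyadic : ∀ᵐ ω ∂P, ∀ (n : ℕ) (k : ℤ), X (k / 2 ^ n) ω = (J (k / 2 ^ n) ω).re :=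
    ae_all_iff.2 fun n => ae_all_iff.2 fun k => hXJ _
  filter_upwards [hX.continuous, hdyadic, hinc] with ω hcont hXω hω
  obtain ⟨n₀, hn₀⟩ := eventually_atTop.1 hω
  obtain ⟨K, hK⟩ := exists_holder_log_bound_of_dyadic hcont hC hH.1
    (by positivity : 0 ≤ 1 / α + δ) (Nat.le_ceil ρ) (n₀ := n₀) (fun n hn k hk => by
      have h1 := hXω n (k + 1)
      push_cast at h1
      rw [h1, hXω n k]
      exact hn₀ n hn k hk)
  refine lt_of_le_of_lt (iSup_le fun t' => iSup_le fun t'' => iSup_le fun ht => ?_)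
    (ENNReal.ofReal_lt_top (r := K))
  obtain ⟨h1, h2, h3⟩ := ht
  have h0 : 0 < t'' - t' := sub_pos.2 h2
  have hlog : 0 < Real.log (1 + (t'' - t')⁻¹) := Real.log_pos (by linarith [inv_pos.2 h0])
  rw [abs_sub_comm t', abs_of_pos h0, abs_sub_comm (X t' ω)]
  exact ENNReal.ofReal_le_ofReal ((div_le_iff₀ (by positivity)).2 (hK t' t'' h1 h2 h3))
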